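/- **Conventions.** An $l$-Calderón–Zygmund kernel on a finite dimensional real Hilbert space $E$ is a tempered distribution $K$ on $E$ which agrees with a locally integrable function away from $0$ and whose Fourier transform (with the normalization $\widehat f(\xi)=\int e^{-2\pi i \xi\cdot x}f(x)\,dx$) is a function with $|\widehat K|\le 1$ that is of class $C^l$ on $E\setminus\{0\}$ and satisfies $|\partial^\alpha \widehat K(\xi)|\le |\xi|^{-|\alpha|}$ for all $\xi\neq 0$, $|\alpha|\le l$ and for the partial derivatives with respect to any orthonormal basis. A datum $\mathbf H=(H;H_0,H_1,H_2,H_3;\Pi_0,\Pi_1,\Pi_2,\Pi_3)$ consists of finite dimensional real Hilbert spaces $H,H_i$ and surjective linear maps $\Pi_i:H\to H_i$. For a tempered distribution $K$ on $H_0$ and Schwartz functions $f_i\in\mathcal S(H_i)$ (complex valued), its form is $$\Lambda_{\mathbf H}(K,f_1,f_2,f_3)=\int_H f_1(\Pi_1x)f_2(\Pi_2x)f_3(\Pi_3x)K(\Pi_0x)\,dx ,$$ understood as $K(G)$, where $G\in\mathcal S(H_0)$ is the density with respect to Lebesgue measure of the push-forward under $\Pi_0$ of $f_1(\Pi_1x)f_2(\Pi_2x)f_3(\Pi_3x)\,dx$;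 the form is defined at $(K,f_1,f_2,f_3)$ if such a Schwartz function $G$ exists. An estimate for the form for all Schwartz functions $f_i$ includes the assertion that the form is defined for all of them. A module $\mathbf M=(M;M_0,M_1,M_2,M_3)$ is a finite dimensional real vector space with four subspaces. Isomorphisms of modules are linear isomorphisms mapping the $i$-th subspace onto the $i$-th subspace for $i=0,1,2,3$, and direct sums of modules are taken componentwise. The module of a datum $\mathbf H$ is $\mathbf M_{\mathbf H}=(H^*;\Pi_0^*H_0^*,\Pi_1^*H_1^*,\Pi_2^*H_2^*,\Pi_3^*H_3^*)$. **Theorem.** Let $\mathbf M,\mathbf M'$ be modules and let $\mathbf p=(p_1,p_2,p_3)$ with $0<p_i<\infty$. Let $\mathbf H$ and $\widetilde{\mathbf H}$ be data with $\mathbf M_{\mathbf H}\cong \mathbf M$ and $\mathbf M_{\widetilde{\mathbf H}}\cong\mathbf M\oplus\mathbf M'$, and let $l\ge 0$ be an integer. Suppose that there is a constant $C$ such that for every $l$-Calderón–Zygmund kernel $K$ on $\widetilde H_0$ and all Schwartz functions $f_i \in \mathcal S(\widetilde H_i)$ $$|\Lambda_{\widetilde{\mathbf H}}(K,f_1,f_2,f_3)|\le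 C\,\|f_1\|_{p_1}\|f_2\|_{p_2}\|f_3\|_{p_3}.$$ Then there is a constant $C'$ such that for every $2l$-Calderón–Zygmund kernel $K$ on $H_0$ and all Schwartz functions $f_i\in\mathcal S(H_i)$ $$|\Lambda_{\mathbf H}(K,f_1,f_2,f_3)|\le C'\,\|f_1\|_{p_1}\|f_2\|_{p_2}\|f_3\|_{p_3}.$$ -/

import Mathlib

open MeasureTheory FourierTransform
open scoped SchwartzMap ENNReal NNReal

universe u v w x

/-- An `l`-Calderón–Zygmund kernel on a finite dimensional Hilbert space `E`: a tempered
distribution `K` that agrees with a (locally integrable) function away from `0` and whose Fourier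
transform is a bounded function `m` that is `l` times continuously differentiable away from `0`,
where for every orthonormal basis all partial derivatives of order `k ≤ l` are bounded by
`‖ξ‖ ^ (-k)`.

The bound `‖m ξ‖ ≤ 1` is required at `ξ = 0` too. This matters only if `E = 0`; otherwise `m` can
be changed at the origin, without changing the distribution. -/
def IsCZKernel {E : Type u} [NormedAddCommGroup E] [InnerProductSpace ℝ E]
    [FiniteDimensional ℝ E] [MeasurableSpace E] [BorelSpace E]
    (l : ℕ) (K : 𝓢'(E, ℂ)) : Prop :=
  (∃ k : E → ℂ, LocallyIntegrableOn k {0}ᶜ volume ∧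
    ∀ φ : 𝓢(E, ℂ), HasCompactSupport φ → (0 : E) ∉ tsupport φ → K φ = ∫ x, k x * φ x) ∧
  ∃ m : E → ℂ,
    (∀ φ : 𝓢(E, ℂ), (𝓕 K) φ = ∫ ξ, m ξ * φ ξ) ∧
    (∀ ξ, ‖m ξ‖ ≤ 1) ∧
    ContDiffOn ℝ l m {0}ᶜ ∧
    ∀ (b : OrthonormalBasis (Fin (Module.finrank ℝ E)) ℝ E) (k : ℕ), k ≤ l →
      ∀ (j : Fin k → Fin (Module.finrank ℝ E)) (ξ : E), ξ ≠ 0 →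
        ‖iteratedFDeriv ℝ k m ξ (fun i => b (j i))‖ ≤ (‖ξ‖ ^ k)⁻¹

/-- A (trilinear) singular Brascamp–Lieb datum: finite dimensional Hilbert spaces `H` and
`S 0, S 1, S 2, S 3` with surjective linear maps `Pr i : H → S i`. -/
structure BLDatum where
  H : Type u
  S : Fin 4 → Type u
  [normH : NormedAddCommGroup H]
  [innerH : InnerProductSpace ℝ H]
  [finH : FiniteDimensional ℝ H]
  [normS : ∀ i, NormedAddCommGroup (S i)]
  [innerS : ∀ i, InnerProductSpace ℝ (S i)]
  [finS : ∀ i, FiniteDimensional ℝ (S i)]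
  Pr : ∀ i, H →ₗ[ℝ] S i
  surj : ∀ i, Function.Surjective (Pr i)

/-- A module (a representation of the four subspace quiver over `ℝ`): a finite dimensional real
vector space `V` with four subspaces `sub 0, sub 1, sub 2, sub 3`. -/
structure FourSubspaceModule where
  V : Type u
  [acg : AddCommGroup V]
  [mod : Module ℝ V]
  [fin : FiniteDimensional ℝ V]
  sub : Fin 4 → Submodule ℝ V

namespace FourSubspaceModule

attribute [instance] acg mod fin

/-- Two modules are isomorphic if some linear isomorphism carries the `i`-th subspace onto the
`i`-th subspace for each `i`. -/
def Iso (M : FourSubspaceModule.{u}) (N : FourSubspaceModule.{v}) : Prop :=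
  ∃ ψ : M.V ≃ₗ[ℝ] N.V, ∀ i, (M.sub i).map (ψ : M.V →ₗ[ℝ] N.V) = N.sub i

/-- The direct sum of two modules. -/
def directSum (M : FourSubspaceModule.{u}) (N : FourSubspaceModule.{v}) :
    FourSubspaceModule.{max u v} where
  V := M.V × N.V
  sub i := (M.sub i).prod (N.sub i)

end FourSubspaceModule

namespace BLDatum

attribute [instance] normH innerH finH normS innerS finS

instance (D : BLDatum.{u}) : MeasurableSpace D.H := borel D.H
instance (D : BLDatum.{u}) : BorelSpace D.H := ⟨rfl⟩
instance (D : BLDatum.{u}) (i : Fin 4) : MeasurableSpace (D.S i) := borel (D.S i)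
instance (D : BLDatum.{u}) (i : Fin 4) : BorelSpace (D.S i) := ⟨rfl⟩

/-- The module associated with a datum: the dual space of `H`, with the images of the dual maps
`(Pr i)^* : (S i)^* → H^*`. -/
def toModule (D : BLDatum.{u}) : FourSubspaceModule.{u} where
  V := Module.Dual ℝ D.H
  sub i := LinearMap.range (D.Pr i).dualMap

/-- The function `x ↦ f₁(Π₁ x) f₂(Π₂ x) f₃(Π₃ x)` on `H`. -/
noncomputable def tensor (D : BLDatum.{u}) (f : ∀ i : Fin 3, 𝓢(D.S i.succ, ℂ)) (x : D.H) : ℂ :=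
  ∏ i : Fin 3, f i (D.Pr i.succ x)

/-- `G` is the Schwartz density of the push-forward under `Π₀` of the (complex) measure
`f₁(Π₁ x) f₂(Π₂ x) f₃(Π₃ x) dx`, that is, `G t` is the integral of the function
`f₁(Π₁ x) f₂(Π₂ x) f₃(Π₃ x)` over the fibre `Π₀ x = t`. -/
def IsFiberIntegral (D : BLDatum.{u}) (f : ∀ i : Fin 3, 𝓢(D.S i.succ, ℂ))
    (G : 𝓢(D.S 0, ℂ)) : Prop :=
  ∀ φ : 𝓢(D.S 0, ℂ), Integrable (fun x => D.tensor f x * φ (D.Pr 0 x)) volume ∧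
    ∫ x, D.tensor f x * φ (D.Pr 0 x) = ∫ t, G t * φ t

/-- The singular Brascamp–Lieb form at `(K, f₁, f₂, f₃)` is defined and its value is `z`:
`z = ∫_H f₁(Π₁ x) f₂(Π₂ x) f₃(Π₃ x) K(Π₀ x) dx`, where the integral over `H` with the distribution
`K` is taken over the fibres of `Π₀` first, and `K` is then applied to the resulting Schwartz
function on `S 0`. -/
def HasForm (D : BLDatum.{u}) (K : 𝓢'(D.S 0, ℂ)) (f : ∀ i : Fin 3, 𝓢(D.S i.succ, ℂ))
    (z : ℂ) : Prop :=
  ∃ G : 𝓢(D.S 0, ℂ), D.IsFiberIntegral f G ∧ K G = z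

/-- For all `l`-Calderón–Zygmund kernels `K` and all Schwartz functions `f₁, f₂, f₃`, the form is
defined and `|Λ(K, f₁, f₂, f₃)| ≤ C ‖f₁‖_{p₁} ‖f₂‖_{p₂} ‖f₃‖_{p₃}`. -/
def BoundedWith (D : BLDatum.{u}) (p : Fin 3 → ℝ≥0∞) (l : ℕ) (C : ℝ≥0) : Prop :=
  ∀ K : 𝓢'(D.S 0, ℂ), IsCZKernel l K → ∀ f : ∀ i : Fin 3, 𝓢(D.S i.succ, ℂ),
    ∃ z : ℂ, D.HasForm K f z ∧ ‖z‖ₑ ≤ C * ∏ i : Fin 3, eLpNorm (f i) (p i) volume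

/-- The fibre integral, hence the value of the form, is unique. -/
theorem IsFiberIntegral.unique {D : BLDatum.{u}} {f : ∀ i : Fin 3, 𝓢(D.S i.succ, ℂ)}
    {G G' : 𝓢(D.S 0, ℂ)} (h : D.IsFiberIntegral f G) (h' : D.IsFiberIntegral f G') : G = G' := by
  have ae : ∀ᵐ t ∂(volume : Measure (D.S 0)), G t = G' t := by
    refine ae_eq_of_integral_contDiff_smul_eq G.continuous.locallyIntegrable
      G'.continuous.locallyIntegrable fun g hg hgc => ?_
    have hc : HasCompactSupport (fun t => (g t : ℂ)) := hgc.comp_left Complex.ofReal_zero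
    have hs : ContDiff ℝ (⊤ : ℕ∞) (fun t => (g t : ℂ)) := Complex.ofRealCLM.contDiff.comp hg
    have key := (h (hc.toSchwartzMap hs)).2.symm.trans (h' (hc.toSchwartzMap hs)).2
    simpa [mul_comm] using key
  ext t
  exact congrFun (Measure.eq_of_ae_eq ae G.continuous G'.continuous) t

end BLDatum

/-! The datum `E` splits, up to linear changes of variables, as `D` plus a complementary datum `D'`,
so the estimate for `E` can be tested on tensor products `f ⊗ f'`. On the Fourier side the form of
`E` is then a constant times `∫ M(Ψ(ξ, η)) g(ξ) g'(η)`, where `M` is the multiplier of the kernel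
and `g`, `g'` are the inverse Fourier transforms of the two fibre integrals. It remains to recover
`∫ m g` for a given multiplier `m` on `D.S 0`.

The function `m(ξ)`, regarded as a function of `(ξ, η)`, is not a Mikhlin multiplier, because its
derivatives are only controlled by `|ξ|`. Multiplied by a smooth homogeneous cutoff to `|η| ≤ |ξ|`
it becomes one, with no loss of derivatives (`exists_mikhlin_lift`). A further Schwartz cutoff at a
large scale makes it integrable, so that its kernel is a function. Dilating `f'` by `t` replaces `η`
by `η / t`; as `t → ∞` the cutoffs tend to `1` and the form tends to a constant times `(∫ m g)(∫
g')` (`exists_isCZMultiplier_tendsto`, `tendsto_integral_multiplier`). A fixed `f'` with `∫ g' ≠ 0`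
can be divided out.

The dilation costs a factor `t ^ κ` (`exists_product_bound`). The constant multiplier `1` gives a
left side independent of `t`, so letting `t → 0` shows `κ ≤ 0`, and the factor is harmless as `t →
∞`.

That the form of `D` is defined comes from joint injectivity of `Pr 1, Pr 2, Pr 3`: it is forced by
the definedness of the form of `E`, it passes to both summands, and it makes the integrand Schwartz.
-/

/-! ### Tensor products and restrictions of Schwartz functions -/

section Tensor

variable {V W : Type*} [NormedAddCommGroup V] [NormedSpace ℝ V]
  [NormedAddCommGroup W] [NormedSpace ℝ W]

/-- The tensor product of two Schwartz functions. -/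
noncomputable def SchwartzMap.tensorProd (f : 𝓢(V, ℂ)) (g : 𝓢(W, ℂ)) : 𝓢(V × W, ℂ) where
  toFun p := f p.1 * g p.2
  smooth' := ((f.smooth ⊤).comp contDiff_fst).mul ((g.smooth ⊤).comp contDiff_snd)
  decay' k n := by
    have h1 : ∀ (i : ℕ) (p : V × W), ‖iteratedFDeriv ℝ i (fun p : V × W => f p.1) p‖ ≤
        ‖iteratedFDeriv ℝ i f p.1‖ := fun i p => by
      have e : (fun p : V × W => f p.1) = f ∘ (ContinuousLinearMap.fst ℝ V W) := rfl
      rw [e, (ContinuousLinearMap.fst ℝ V W).iteratedFDeriv_comp_right (f.smooth ⊤) p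
        (i := i) (by exact_mod_cast le_top)]
      refine (ContinuousMultilinearMap.norm_compContinuousLinearMap_le _ _).trans ?_
      refine mul_le_of_le_one_right (norm_nonneg _) ?_
      exact Finset.prod_le_one (fun _ _ => norm_nonneg _)
        fun _ _ => ContinuousLinearMap.norm_fst_le ℝ V W
    have h2 : ∀ (i : ℕ) (p : V × W), ‖iteratedFDeriv ℝ i (fun p : V × W => g p.2) p‖ ≤
        ‖iteratedFDeriv ℝ i g p.2‖ := fun i p => by
      have e : (fun p : V × W => g p.2) = g ∘ (ContinuousLinearMap.snd ℝ V W) := rfl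
      rw [e, (ContinuousLinearMap.snd ℝ V W).iteratedFDeriv_comp_right (g.smooth ⊤) p
        (i := i) (by exact_mod_cast le_top)]
      refine (ContinuousMultilinearMap.norm_compContinuousLinearMap_le _ _).trans ?_
      refine mul_le_of_le_one_right (norm_nonneg _) ?_
      exact Finset.prod_le_one (fun _ _ => norm_nonneg _)
        fun _ _ => ContinuousLinearMap.norm_snd_le ℝ V W
    choose A hA0 hA using fun k n => f.decay k n
    choose B hB0 hB using fun k n => g.decay k n
    refine ⟨∑ i ∈ Finset.range (n + 1), (n.choose i : ℝ) *
      (A k i * B 0 (n - i) + A 0 i * B k (n - i)), fun p => ?_⟩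
    have hL := norm_iteratedFDeriv_mul_le (𝕜 := ℝ) (N := (⊤ : ℕ∞))
      ((f.smooth ⊤).comp (contDiff_fst (E := V) (F := W)))
      ((g.smooth ⊤).comp (contDiff_snd (E := V) (F := W))) p (n := n)
      (by exact_mod_cast le_top)
    refine (mul_le_mul_of_nonneg_left hL (by positivity)).trans ?_
    rw [Finset.mul_sum]
    refine Finset.sum_le_sum fun i _ => ?_
    have hp : ‖p‖ ^ k ≤ ‖p.1‖ ^ k + ‖p.2‖ ^ k := by
      rcases max_choice ‖p.1‖ ‖p.2‖ with h | h <;> rw [Prod.norm_def, h]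
      · exact le_add_of_nonneg_right (by positivity)
      · exact le_add_of_nonneg_left (by positivity)
    have e1 := hA k i p.1
    have e2 := hA 0 i p.1
    have e3 := hB k (n - i) p.2
    have e4 := hB 0 (n - i) p.2
    rw [pow_zero, one_mul] at e2 e4
    set a := ‖iteratedFDeriv ℝ i f p.1‖
    set b := ‖iteratedFDeriv ℝ (n - i) g p.2‖
    have ha : 0 ≤ a := norm_nonneg _
    have hb : 0 ≤ b := norm_nonneg _
    calc ‖p‖ ^ k * ((n.choose i : ℝ) * ‖iteratedFDeriv ℝ i (fun p : V × W => f p.1) p‖ *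
          ‖iteratedFDeriv ℝ (n - i) (fun p : V × W => g p.2) p‖)
        ≤ (‖p.1‖ ^ k + ‖p.2‖ ^ k) * ((n.choose i : ℝ) * a * b) := by
          gcongr
          · exact h1 i p
          · exact h2 (n - i) p
      _ = (n.choose i : ℝ) * ((‖p.1‖ ^ k * a) * b + a * (‖p.2‖ ^ k * b)) := by ring
      _ ≤ _ := by
          have := (by positivity : 0 ≤ ‖p.1‖ ^ k * a).trans e1
          have := ha.trans e2
          gcongr

@[simp] theorem SchwartzMap.tensorProd_apply (f : 𝓢(V, ℂ)) (g : 𝓢(W, ℂ)) (p : V × W) :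
    f.tensorProd g p = f p.1 * g p.2 := rfl

/-- The composition of a Schwartz function with an injective linear map. -/
theorem SchwartzMap.exists_comp_injective [FiniteDimensional ℝ V] (f : 𝓢(W, ℂ)) (L : V →L[ℝ] W)
    (hL : Function.Injective L) : ∃ g : 𝓢(V, ℂ), ∀ x, g x = f (L x) := by
  obtain ⟨K, -, hK⟩ := LinearMap.exists_antilipschitzWith (L : V →ₗ[ℝ] W)
    (LinearMap.ker_eq_bot.2 hL)
  exact ⟨SchwartzMap.compCLMOfAntilipschitz ℂ L.hasTemperateGrowth hK f, fun x => rfl⟩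

/-- The tensor product of Schwartz functions along jointly injective linear maps. -/
theorem SchwartzMap.exists_mul_comp {U : Type*} [NormedAddCommGroup U] [NormedSpace ℝ U]
    [FiniteDimensional ℝ U] (f : 𝓢(V, ℂ)) (g : 𝓢(W, ℂ)) (L : U →L[ℝ] V × W)
    (h : Function.Injective L) : ∃ F : 𝓢(U, ℂ), ∀ x, F x = f (L x).1 * g (L x).2 :=
  (f.tensorProd g).exists_comp_injective L h

end Tensor

/-! ### Fibre integrals through the Fourier transform -/

section Fiber

variable {H S : Type*} [NormedAddCommGroup H] [InnerProductSpace ℝ H] [FiniteDimensional ℝ H]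
  [MeasurableSpace H] [BorelSpace H]
  [NormedAddCommGroup S] [InnerProductSpace ℝ S] [FiniteDimensional ℝ S]
  [MeasurableSpace S] [BorelSpace S]

/-- Fibre integrals of Schwartz functions along surjective linear maps are Schwartz functions. -/
theorem SchwartzMap.exists_fiberIntegral (P : H →L[ℝ] S) (hP : Function.Surjective P)
    (F : 𝓢(H, ℂ)) : ∃ G : 𝓢(S, ℂ), (∀ ξ, 𝓕⁻ G ξ = 𝓕⁻ F (P.adjoint ξ)) ∧
      ∀ φ : 𝓢(S, ℂ), Integrable (fun x => F x * φ (P x)) ∧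
        ∫ x, F x * φ (P x) = ∫ t, G t * φ t := by
  have hinj : Function.Injective P.adjoint := by
    rw [← ContinuousLinearMap.coe_coe, ← LinearMap.ker_eq_bot, LinearMap.ker_eq_bot']
    intro ξ hξ
    obtain ⟨x, rfl⟩ := hP ξ
    have : inner ℝ x (P.adjoint (P x)) = 0 := by
      rw [show P.adjoint (P x) = 0 from hξ, inner_zero_right]
    rwa [ContinuousLinearMap.adjoint_inner_right, inner_self_eq_zero] at this
  -- Fourier slices: the inverse transform of the fibre integral must be `𝓕⁻ F` restricted along the
  -- adjoint, and this restriction is Schwartz because the adjoint is injective.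
  obtain ⟨g, hg⟩ := (𝓕⁻ F).exists_comp_injective P.adjoint hinj
  refine ⟨𝓕 g, fun ξ => by rw [FourierTransform.fourierInv_fourier_eq, hg], fun φ => ⟨?_, ?_⟩⟩
  · obtain ⟨C, -, hC⟩ := φ.decay 0 0
    refine F.integrable.mul_bdd (c := C) (φ.continuous.comp P.continuous).aestronglyMeasurable
      (Filter.Eventually.of_forall fun x => ?_)
    simpa using hC (P x)
  · have e1 : ∫ t, (𝓕 g) t * φ t = ∫ t, g t * (𝓕 φ) t := SchwartzMap.integral_fourier_mul_eq g φ
    rw [e1]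
    -- The pairing `-⟨P x, ξ⟩` between `H` and `S` lets Fubini move the transform directly from one
    -- space to the other; the sign produces inverse transforms.
    let L : H →L[ℝ] S →L[ℝ] ℝ := -((innerSL ℝ).comp P)
    have key := VectorFourier.integral_fourierIntegral_smul_eq_flip (e := Real.fourierChar)
      (μ := (volume : Measure H)) (ν := (volume : Measure S)) (L := L.toLinearMap₁₂)
      (f := (F : H → ℂ)) (g := (𝓕 φ : 𝓢(S, ℂ))) Real.continuous_fourierChar (by
        exact L.continuous₂) F.integrable (𝓕 φ).integrable
    have e2 : ∀ ξ, VectorFourier.fourierIntegral Real.fourierChar volume L.toLinearMap₁₂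
        (F : H → ℂ) ξ = g ξ := by
      intro ξ
      rw [hg, SchwartzMap.fourierInv_coe, Real.fourierInv_eq, VectorFourier.fourierIntegral]
      refine integral_congr_ae (Filter.Eventually.of_forall fun v => ?_)
      simp [L, ContinuousLinearMap.adjoint_inner_right]
    have e3 : ∀ x, VectorFourier.fourierIntegral Real.fourierChar volume L.toLinearMap₁₂.flip
        (𝓕 φ : 𝓢(S, ℂ)) x = φ (P x) := by
      intro x
      have e4 : φ (P x) = (𝓕⁻ (𝓕 φ)) (P x) :=
        congrArg (fun ψ : 𝓢(S, ℂ) => ψ (P x)) (FourierTransform.fourierInv_fourier_eq φ).symm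
      rw [e4, SchwartzMap.fourierInv_coe (𝓕 φ), Real.fourierInv_eq, VectorFourier.fourierIntegral]
      refine integral_congr_ae (Filter.Eventually.of_forall fun v => ?_)
      simp [L, real_inner_comm]
    simp only [e2, e3, smul_eq_mul] at key
    exact key.symm

end Fiber

/-! ### The complementary datum -/

section Complement

/-- Two surjective linear maps with the same kernel differ by a linear isomorphism. -/
theorem LinearMap.exists_equiv_of_ker_eq {V W X : Type*} [AddCommGroup V] [Module ℝ V]
    [AddCommGroup W] [Module ℝ W] [AddCommGroup X] [Module ℝ X] (f : V →ₗ[ℝ] W) (g : V →ₗ[ℝ] X)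
    (hf : Function.Surjective f) (hg : Function.Surjective g) (h : ∀ v, f v = 0 ↔ g v = 0) :
    ∃ e : W ≃ₗ[ℝ] X, ∀ v, e (f v) = g v := by
  have hk : LinearMap.ker f = LinearMap.ker g := by ext v; exact h v
  refine ⟨(f.quotKerEquivOfSurjective hf).symm.trans ((Submodule.quotEquivOfEq _ _ hk).trans
    (g.quotKerEquivOfSurjective hg)), fun v => ?_⟩
  have : (f.quotKerEquivOfSurjective hf).symm (f v) = Submodule.Quotient.mk v := by
    rw [LinearEquiv.symm_apply_eq]; rfl
  rw [LinearEquiv.trans_apply, this]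
  rfl

/-- There is a datum whose maps have prescribed kernels in a given vector space. -/
theorem BLDatum.exists_of_ker (W : Type*) [AddCommGroup W] [Module ℝ W] [FiniteDimensional ℝ W]
    (K : Fin 4 → Submodule ℝ W) : ∃ (D : BLDatum.{0}) (τ : D.H ≃ₗ[ℝ] W),
      ∀ i v, D.Pr i v = 0 ↔ τ v ∈ K i := by
  let τ : EuclideanSpace ℝ (Fin (Module.finrank ℝ W)) ≃ₗ[ℝ] W :=
    LinearEquiv.ofFinrankEq _ _ finrank_euclideanSpace_fin
  let K' := fun i => (K i).comap τ.toLinearMap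
  refine ⟨⟨EuclideanSpace ℝ (Fin (Module.finrank ℝ W)), fun i => (K' i)ᗮ,
    fun i => ((K' i)ᗮ.orthogonalProjectionOnto : _ →ₗ[ℝ] (K' i)ᗮ), fun i y => ⟨y,
      Submodule.orthogonalProjectionOnto_mem_subspace_eq_self y⟩⟩, τ, fun i v => ?_⟩
  change (K' i)ᗮ.orthogonalProjectionOnto v = 0 ↔ v ∈ K' i
  rw [Submodule.orthogonalProjectionOnto_eq_zero_iff, Submodule.orthogonal_orthogonal]

theorem FourSubspaceModule.Iso.exists_mem_iff {M : FourSubspaceModule.{u}}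
    {N : FourSubspaceModule.{v}} (h : M.Iso N) :
    ∃ ψ : M.V ≃ₗ[ℝ] N.V, ∀ i q, ψ q ∈ N.sub i ↔ q ∈ M.sub i := by
  obtain ⟨ψ, hψ⟩ := h
  refine ⟨ψ, fun i q => ?_⟩
  rw [← hψ i, Submodule.mem_map_equiv, LinearEquiv.symm_apply_apply]

/-- If the module of `E` is the direct sum of the module of `D` and another module, then `E` is
linearly equivalent to the direct sum of `D` and another datum. -/
theorem BLDatum.exists_complement {M : FourSubspaceModule.{u}} {M' : FourSubspaceModule.{v}}
    {D : BLDatum.{w}} {E : BLDatum.{x}}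
    (hD : D.toModule.Iso M) (hE : E.toModule.Iso (M.directSum M')) :
    ∃ (D' : BLDatum.{0}) (Φ : (D.H × D'.H) ≃L[ℝ] E.H) (Θ : ∀ i, (D.S i × D'.S i) ≃L[ℝ] E.S i),
      ∀ i u v, E.Pr i (Φ (u, v)) = Θ i (D.Pr i u, D'.Pr i v) := by
  obtain ⟨ψ, hψ⟩ : ∃ ψ : Module.Dual ℝ D.H ≃ₗ[ℝ] M.V,
    ∀ i q, ψ q ∈ M.sub i ↔ q ∈ LinearMap.range (D.Pr i).dualMap := hD.exists_mem_iff
  obtain ⟨χ, hχ⟩ : ∃ χ : Module.Dual ℝ E.H ≃ₗ[ℝ] M.V × M'.V, ∀ i q,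
    χ q ∈ (M.sub i).prod (M'.sub i) ↔ q ∈ LinearMap.range (E.Pr i).dualMap := hE.exists_mem_iff
  let ω : (Module.Dual ℝ D.H × M'.V) ≃ₗ[ℝ] Module.Dual ℝ E.H :=
    (LinearEquiv.prodCongr ψ (LinearEquiv.refl ℝ M'.V)).trans χ.symm
  have hω : ∀ i (q : Module.Dual ℝ D.H × M'.V), ω q ∈ LinearMap.range (E.Pr i).dualMap ↔
      q.1 ∈ LinearMap.range (D.Pr i).dualMap ∧ q.2 ∈ M'.sub i := by
    intro i q
    rw [← hχ, LinearEquiv.trans_apply, LinearEquiv.apply_symm_apply, Submodule.mem_prod, ← hψ]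
    rfl
  -- By duality the complement lives on the dual of `M'.V`, and the kernel of its `i`-th map has to
  -- be the annihilator of the `i`-th subspace.
  obtain ⟨D', τ, hτ⟩ := BLDatum.exists_of_ker (Module.Dual ℝ M'.V)
    fun i => (M'.sub i).dualAnnihilator
  have hK : ∀ i v, D'.Pr i v = 0 ↔ ∀ b ∈ M'.sub i, τ v b = 0 := fun i v => by
    rw [hτ, Submodule.mem_dualAnnihilator]
  -- The transpose of `ω⁻¹`, after identifying spaces with their biduals.
  let Φ : (D.H × D'.H) ≃ₗ[ℝ] E.H :=
    (LinearEquiv.prodCongr (Module.evalEquiv ℝ D.H) τ).trans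
      ((Module.dualProdDualEquivDual ℝ (Module.Dual ℝ D.H) M'.V).trans
        (ω.symm.dualMap.trans (Module.evalEquiv ℝ E.H).symm))
  have hΦ : ∀ u v q, ω q (Φ (u, v)) = q.1 u + τ v q.2 := by
    intro u v q
    have h1 : ω q (Φ (u, v)) = Module.evalEquiv ℝ E.H (Φ (u, v)) (ω q) := rfl
    rw [h1]
    simp only [Φ, LinearEquiv.trans_apply, LinearEquiv.apply_symm_apply]
    rw [LinearEquiv.dualMap_apply, LinearEquiv.symm_apply_apply]
    rfl
  have hker : ∀ i u v, E.Pr i (Φ (u, v)) = 0 ↔ D.Pr i u = 0 ∧ D'.Pr i v = 0 := by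
    intro i u v
    rw [hK, ← Module.forall_dual_apply_eq_zero_iff ℝ, ← Module.forall_dual_apply_eq_zero_iff ℝ]
    constructor
    · intro h
      have h2 : ∀ q : Module.Dual ℝ D.H × M'.V, q.1 ∈ LinearMap.range (D.Pr i).dualMap →
          q.2 ∈ M'.sub i → q.1 u + τ v q.2 = 0 := by
        intro q h1 h2
        obtain ⟨lam, hl⟩ := (hω i q).2 ⟨h1, h2⟩
        rw [← hΦ, ← hl]
        exact h lam
      refine ⟨fun lam => ?_, fun b hb => ?_⟩
      · simpa using h2 ((D.Pr i).dualMap lam, 0) ⟨lam, rfl⟩ (zero_mem _)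
      · simpa using h2 (0, b) (zero_mem _) hb
    · rintro ⟨h1, h2⟩ lam
      obtain ⟨q, hq⟩ := ω.surjective ((E.Pr i).dualMap lam)
      obtain ⟨⟨ν, hν⟩, hb⟩ := (hω i q).1 ⟨lam, hq.symm⟩
      have h3 : lam (E.Pr i (Φ (u, v))) = ω q (Φ (u, v)) := by rw [hq]; rfl
      rw [h3, hΦ, h2 _ hb, ← hν, add_zero]
      exact h1 ν
  have hΘ : ∀ i, ∃ e : (D.S i × D'.S i) ≃ₗ[ℝ] E.S i,
      ∀ q : D.H × D'.H,
        e ((D.Pr i).prodMap (D'.Pr i) q) = ((E.Pr i) ∘ₗ Φ.toLinearMap) q := by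
    intro i
    refine LinearMap.exists_equiv_of_ker_eq _ _
      (Function.Surjective.prodMap (D.surj i) (D'.surj i))
      ((E.surj i).comp Φ.surjective) ?_
    rintro ⟨u, v⟩
    rw [LinearMap.comp_apply, LinearEquiv.coe_coe, hker, LinearMap.prodMap_apply, Prod.mk_eq_zero]
  choose Θ hΘ using hΘ
  exact ⟨D', Φ.toContinuousLinearEquiv, fun i => (Θ i).toContinuousLinearEquiv,
    fun i u v => (hΘ i (u, v)).symm⟩

end Complement

/-! ### Joint injectivity from definedness of the form -/

section Bump

variable {V : Type*} [NormedAddCommGroup V] [InnerProductSpace ℝ V] [FiniteDimensional ℝ V]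

/-- There is a nonnegative Schwartz function with value one at the origin. -/
theorem SchwartzMap.exists_bump (V : Type*) [NormedAddCommGroup V] [InnerProductSpace ℝ V]
    [FiniteDimensional ℝ V] : ∃ (φ : 𝓢(V, ℂ)) (ρ : V → ℝ), Continuous ρ ∧ (∀ x, φ x = ρ x) ∧
      (∀ x, 0 ≤ ρ x) ∧ ρ 0 = 1 := by
  let b : ContDiffBump (0 : V) := ⟨1, 2, one_pos, one_lt_two⟩
  have hc : HasCompactSupport (fun t => (b t : ℂ)) :=
    b.hasCompactSupport.comp_left Complex.ofReal_zero
  have hs : ContDiff ℝ (⊤ : ℕ∞) (fun t => (b t : ℂ)) := Complex.ofRealCLM.contDiff.comp b.contDiff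
  exact ⟨hc.toSchwartzMap hs, b, b.continuous, fun x => rfl, fun x => b.nonneg,
    b.one_of_mem_closedBall (by simp [b])⟩

variable [MeasurableSpace V] [BorelSpace V]

theorem integral_ne_zero_of_eq_ofReal {h : V → ℂ} {r : V → ℝ} (hr : Continuous r)
    (hh : ∀ x, h x = r x) (hi : Integrable h) (h0 : ∀ x, 0 ≤ r x) {x₀ : V} (hx : r x₀ ≠ 0) :
    ∫ x, h x ≠ 0 := by
  have e : h = fun x => (r x : ℂ) := funext hh
  rw [e] at hi ⊢
  rw [integral_complex_ofReal, Complex.ofReal_ne_zero]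
  exact (integral_pos_of_integrable_nonneg_nonzero hr
    (by simpa using hi.re) (fun x => h0 x) hx).ne'

/-- Integrals of an integrable function against far translates of a Schwartz function vanish in
the limit. -/
theorem tendsto_integral_mul_translate {P : V → ℂ} (hP : Integrable P) (ψ : 𝓢(V, ℂ)) {v : V}
    (hv : v ≠ 0) :
    Filter.Tendsto (fun k : ℕ => ∫ x, P x * ψ (x + (k : ℝ) • v)) Filter.atTop (nhds 0) := by
  obtain ⟨C, hC0, hC⟩ := ψ.decay 0 0
  have h0 : (0 : ℂ) = ∫ x : V, (0 : ℂ) := by simp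
  rw [h0]
  refine tendsto_integral_of_dominated_convergence (fun x => ‖P x‖ * C) (fun k => ?_)
    (hP.norm.mul_const C) (fun k => Filter.Eventually.of_forall fun x => ?_)
    (Filter.Eventually.of_forall fun x => ?_)
  · exact hP.1.mul (ψ.continuous.comp (continuous_id.add continuous_const)).aestronglyMeasurable
  · rw [norm_mul]
    gcongr
    simpa using hC (x + (k : ℝ) • v)
  · have h1 : Filter.Tendsto (fun k : ℕ => x + (k : ℝ) • v) Filter.atTop
        (Filter.cocompact V) := by
      rw [← Metric.cobounded_eq_cocompact, ← tendsto_norm_atTop_iff_cobounded]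
      refine Filter.tendsto_atTop_mono (f := fun k : ℕ => (k : ℝ) * ‖v‖ - ‖x‖) (fun k => ?_)
        (Filter.tendsto_atTop_add_const_right _ _
          (tendsto_natCast_atTop_atTop.atTop_mul_const (norm_pos_iff.2 hv)))
      have h2 := norm_sub_le (x + (k : ℝ) • v) x
      rw [add_sub_cancel_left, norm_smul, Real.norm_natCast] at h2
      linarith
    simpa using (ψ.tendsto_cocompact.comp h1).const_mul (P x)

end Bump

/-- The zero distribution is a Calderón–Zygmund kernel. -/
theorem isCZKernel_zero {E : Type u} [NormedAddCommGroup E] [InnerProductSpace ℝ E]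
    [FiniteDimensional ℝ E] [MeasurableSpace E] [BorelSpace E] (l : ℕ) :
    IsCZKernel l (0 : 𝓢'(E, ℂ)) := by
  refine ⟨⟨0, locallyIntegrableOn_zero, fun φ _ _ => by simp⟩, 0, fun φ => by simp, by simp,
    contDiffOn_const, fun b k _ j ξ _ => ?_⟩
  have : (0 : E → ℂ) = fun _ => 0 := rfl
  rw [this, iteratedFDeriv_fun_zero]
  simp

namespace BLDatum

/-- If the form is defined for all Schwartz functions, then the maps `Pr 1, Pr 2, Pr 3` are jointly
injective. -/
theorem BoundedWith.eq_zero_of_Pr_eq_zero {E : BLDatum.{u}} {p : Fin 3 → ℝ≥0∞} {l : ℕ} {C : ℝ≥0}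
    (h : E.BoundedWith p l C) {v : E.H} (hv : ∀ i : Fin 3, E.Pr i.succ v = 0) : v = 0 := by
  by_contra hv0
  choose f ρ hρc hfρ hρ0 hρ1 using fun i : Fin 3 => SchwartzMap.exists_bump (E.S i.succ)
  obtain ⟨φ, σ, hσc, hφσ, hσ0, hσ1⟩ := SchwartzMap.exists_bump (E.S 0)
  obtain ⟨ψ, κ, hκc, hψκ, hκ0, hκ1⟩ := SchwartzMap.exists_bump E.H
  -- The zero kernel makes the inequality empty; what is used is the existence of `G`.
  obtain ⟨z, ⟨G, hG, -⟩, -⟩ := h 0 (isCZKernel_zero l) f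
  have hcont : ∀ i, Continuous (E.Pr i) := fun i => (E.Pr i).continuous_of_finiteDimensional
  have htc : Continuous fun x => ∏ i : Fin 3, ρ i (E.Pr i.succ x) :=
    continuous_finsetProd _ fun i _ => (hρc i).comp (hcont _)
  have ht : ∀ x, E.tensor f x = ((∏ i : Fin 3, ρ i (E.Pr i.succ x) : ℝ) : ℂ) := fun x => by
    simp [tensor, hfρ]
  have htv : ∀ (k : ℕ) x, E.tensor f (x + (k : ℝ) • v) = E.tensor f x := fun k x => by
    simp [tensor, hv]
  -- The integrand is invariant under `v`. Either it stays invariant after multiplication by `φ ∘ Pr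
  -- 0`, against integrability on `H`, or `G` is invariant under the nonzero vector `Pr 0 v`,
  -- against its integrability.
  by_cases hu : E.Pr 0 v = 0
  · have hconst : ∀ k : ℕ,
        ∫ x, (E.tensor f x * φ (E.Pr 0 x)) * ψ (x + (k : ℝ) • v) =
        ∫ x, (E.tensor f x * φ (E.Pr 0 x)) * ψ x := fun k => by
      rw [← integral_add_right_eq_self (fun x => (E.tensor f x * φ (E.Pr 0 x)) * ψ x)
        ((k : ℝ) • v)]
      simp only [htv, map_add, map_smul, hu, smul_zero, add_zero]
    have hl := tendsto_integral_mul_translate (hG φ).1 ψ hv0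
    simp only [hconst] at hl
    refine integral_ne_zero_of_eq_ofReal (x₀ := (0 : E.H)) (r := fun x =>
      (∏ i : Fin 3, ρ i (E.Pr i.succ x)) * σ (E.Pr 0 x) * κ x)
      ((htc.mul (hσc.comp (hcont 0))).mul hκc) (fun x => ?_) ?_ (fun x => ?_) ?_
      (tendsto_const_nhds_iff.1 hl)
    · simp [ht, hφσ, hψκ]
    · obtain ⟨c, -, hc⟩ := ψ.decay 0 0
      exact (hG φ).1.mul_bdd (c := c) ψ.continuous.aestronglyMeasurable
        (Filter.Eventually.of_forall fun x => by simpa using hc x)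
    · exact mul_nonneg (mul_nonneg (Finset.prod_nonneg fun i _ => hρ0 _ _) (hσ0 _)) (hκ0 _)
    · simp [hρ1, hσ1, hκ1]
  · have hconst : ∀ k : ℕ, ∫ t, G t * φ (t + (k : ℝ) • E.Pr 0 v) =
        ∫ x, E.tensor f x * φ (E.Pr 0 x) := fun k => by
      have := (hG (SchwartzMap.compSubConstCLM ℂ (-((k : ℝ) • E.Pr 0 v)) φ)).2
      simp only [SchwartzMap.compSubConstCLM_apply, sub_neg_eq_add] at this
      rw [← this, ← integral_add_right_eq_self (fun x => E.tensor f x * φ (E.Pr 0 x))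
        ((k : ℝ) • v)]
      simp only [htv, map_add, map_smul]
    have hl := tendsto_integral_mul_translate G.integrable φ hu
    simp only [hconst] at hl
    refine integral_ne_zero_of_eq_ofReal (x₀ := (0 : E.H)) (r := fun x =>
      (∏ i : Fin 3, ρ i (E.Pr i.succ x)) * σ (E.Pr 0 x))
      (htc.mul (hσc.comp (hcont 0))) (fun x => ?_) (hG φ).1 (fun x => ?_) ?_
      (tendsto_const_nhds_iff.1 hl)
    · simp [ht, hφσ]
    · exact mul_nonneg (Finset.prod_nonneg fun i _ => hρ0 _ _) (hσ0 _)
    · simp [hρ1, hσ1]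

end BLDatum

/-! ### Kernels with prescribed multipliers -/

section Kernel

variable {V : Type u} [NormedAddCommGroup V] [InnerProductSpace ℝ V] [FiniteDimensional ℝ V]
  [MeasurableSpace V] [BorelSpace V]

/-- A Mikhlin multiplier which is either integrable or constant is the Fourier transform of a
Calderón–Zygmund kernel. -/
theorem exists_isCZKernel {l : ℕ} {m : V → ℂ} (hm : ContDiffOn ℝ l m {0}ᶜ) (hb : ∀ ξ, ‖m ξ‖ ≤ 1)
    (hd : ∀ k ≤ l, ∀ ξ ≠ 0, ‖iteratedFDeriv ℝ k m ξ‖ ≤ (‖ξ‖ ^ k)⁻¹)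
    (hi : Integrable m ∨ ∃ c, m = fun _ => c) :
    ∃ K : 𝓢'(V, ℂ), IsCZKernel l K ∧ ∀ φ : 𝓢(V, ℂ), (𝓕 K) φ = ∫ ξ, m ξ * φ ξ := by
  have hmeas : Measurable m := measurable_of_continuousOn_compl_singleton 0 hm.continuousOn
  have hL : MemLp m ⊤ (volume : Measure V) := memLp_top_of_bound hmeas.aestronglyMeasurable 1
    (Filter.Eventually.of_forall hb)
  let T : 𝓢'(V, ℂ) := Lp.toTemperedDistribution hL.toLp
  have hT : ∀ φ : 𝓢(V, ℂ), T φ = ∫ ξ, m ξ * φ ξ := fun φ => by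
    rw [Lp.toTemperedDistribution_apply]
    refine integral_congr_ae ?_
    filter_upwards [hL.coeFn_toLp] with ξ h
    rw [h, smul_eq_mul, mul_comm]
  have hK : ∀ φ : 𝓢(V, ℂ), (𝓕 (𝓕⁻ T)) φ = ∫ ξ, m ξ * φ ξ := fun φ => by
    rw [← hT]
    exact congrArg (fun S : 𝓢'(V, ℂ) => S φ) (FourierTransform.fourier_fourierInv_eq T)
  refine ⟨𝓕⁻ T, ⟨?_, m, hK, hb, hm, fun b k hk j ξ hξ => ?_⟩, hK⟩
  -- An integrable multiplier has a continuous inverse transform; a constant one gives a multiple of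
  -- the Dirac mass, which is zero away from the origin.
  · rcases hi with hi | ⟨c, rfl⟩
    · let L : V →L[ℝ] V →L[ℝ] ℝ := -(innerSL ℝ)
      have hLc : Continuous fun q : V × V => L.toLinearMap₁₂ q.1 q.2 := L.continuous₂
      refine ⟨VectorFourier.fourierIntegral Real.fourierChar volume L.toLinearMap₁₂ m,
        (VectorFourier.fourierIntegral_continuous Real.continuous_fourierChar hLc
          hi).locallyIntegrable.locallyIntegrableOn _, fun φ _ _ => ?_⟩
      have key := VectorFourier.integral_fourierIntegral_smul_eq_flip (e := Real.fourierChar)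
        (μ := (volume : Measure V)) (ν := (volume : Measure V)) (L := L.toLinearMap₁₂)
        (f := m) (g := φ) Real.continuous_fourierChar hLc hi φ.integrable
      simp only [smul_eq_mul] at key
      rw [key, TemperedDistribution.fourierInv_apply, hT]
      congr 1
      ext x
      rw [SchwartzMap.fourierInv_coe, Real.fourierInv_eq, VectorFourier.fourierIntegral]
      congr 2
      ext v
      rw [show L.toLinearMap₁₂.flip v x = -inner ℝ v x by
        rw [real_inner_comm]; rfl, neg_neg]
    · refine ⟨0, locallyIntegrableOn_zero, fun φ _ h0 => ?_⟩
      rw [TemperedDistribution.fourierInv_apply, hT, integral_const_mul]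
      have e : ∫ ξ, (𝓕⁻ φ) ξ = (𝓕 (𝓕⁻ φ)) 0 := by
        rw [SchwartzMap.fourier_coe, Real.fourier_eq]
        simp
      have e2 : (𝓕 (𝓕⁻ φ)) 0 = φ 0 :=
        congrArg (fun ψ : 𝓢(V, ℂ) => ψ 0) (FourierTransform.fourier_fourierInv_eq φ)
      rw [e, e2, image_eq_zero_of_notMem_tsupport h0]
      simp
  · refine (ContinuousMultilinearMap.le_opNorm _ _).trans ?_
    simpa using hd k hk ξ hξ

end Kernel

/-- The derivatives of a multiplier are bounded by the partial derivatives. -/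
theorem ContinuousMultilinearMap.opNorm_le_of_orthonormalBasis {n k : ℕ}
    {V : Type*} [NormedAddCommGroup V] [InnerProductSpace ℝ V] (b : OrthonormalBasis (Fin n) ℝ V)
    (A : V [×k]→L[ℝ] ℂ) {B : ℝ} (hB : 0 ≤ B)
    (h : ∀ j : Fin k → Fin n, ‖A fun i => b (j i)‖ ≤ B) : ‖A‖ ≤ (n : ℝ) ^ k * B := by
  refine A.opNorm_le_bound (by positivity) fun v => ?_
  have e : A v = ∑ j : Fin k → Fin n, (∏ i, inner ℝ (b (j i)) (v i)) • A fun i => b (j i) := by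
    have e1 : v = fun i => ∑ a, inner ℝ (b a) (v i) • b a := funext fun i => (b.sum_repr' _).symm
    conv_lhs => rw [e1]
    rw [A.map_sum]
    exact Finset.sum_congr rfl fun j _ => A.map_smul_univ _ _
  rw [e]
  refine (norm_sum_le _ _).trans ((Finset.sum_le_card_nsmul _ _ (B * ∏ i, ‖v i‖)
    fun j _ => ?_).trans (by simp [mul_assoc]))
  rw [norm_smul, mul_comm, norm_prod]
  refine mul_le_mul (h j) (Finset.prod_le_prod (fun _ _ => norm_nonneg _) fun i _ => ?_)
    (Finset.prod_nonneg fun _ _ => norm_nonneg _) hB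
  simpa using norm_inner_le_norm (𝕜 := ℝ) (b (j i)) (v i)

/-! ### Calculus of scale invariant bounds -/

section Mikhlin

variable {V W : Type*} [NormedAddCommGroup V] [NormedSpace ℝ V]
  [NormedAddCommGroup W] [NormedSpace ℝ W]

/-- The scale invariant bounds of order `l` for a multiplier at a point. -/
structure MikhlinAt (l : ℕ) (B : ℝ) (m : V → ℂ) (ξ : V) : Prop where
  contDiffAt : ContDiffAt ℝ l m ξ
  bound : ∀ k ≤ l, ‖ξ‖ ^ k * ‖iteratedFDeriv ℝ k m ξ‖ ≤ B

theorem ContDiffAt.exists_isOpen {l : ℕ} {m : V → ℂ} {ξ : V} (h : ContDiffAt ℝ l m ξ) :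
    ∃ U, IsOpen U ∧ ξ ∈ U ∧ ContDiffOn ℝ l m U := by
  obtain ⟨U, hU, hc⟩ := h.contDiffOn (m := l) le_rfl (by simp)
  obtain ⟨O, hOU, hO, hξ⟩ := mem_nhds_iff.1 hU
  exact ⟨O, hO, hξ, hc.mono hOU⟩

theorem norm_iteratedFDeriv_comp_right_le {l k : ℕ} (hk : k ≤ l) (g : W →L[ℝ] V) {m : V → ℂ}
    {ζ : W} (h : ContDiffAt ℝ l m (g ζ)) :
    ‖iteratedFDeriv ℝ k (fun x => m (g x)) ζ‖ ≤ ‖iteratedFDeriv ℝ k m (g ζ)‖ * ‖g‖ ^ k := by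
  obtain ⟨U, hU, hζ, hc⟩ := h.exists_isOpen
  have hgU : IsOpen (g ⁻¹' U) := hU.preimage g.continuous
  have e := g.iteratedFDerivWithin_comp_right hc hU.uniqueDiffOn hgU.uniqueDiffOn hζ
    (i := k) (by exact_mod_cast hk)
  rw [iteratedFDerivWithin_of_isOpen k hgU hζ, iteratedFDerivWithin_of_isOpen k hU hζ] at e
  rw [show (fun x => m (g x)) = m ∘ g from rfl, e]
  refine (ContinuousMultilinearMap.norm_compContinuousLinearMap_le _ _).trans ?_
  simp

namespace MikhlinAt

theorem nonneg {l : ℕ} {A : ℝ} {f : V → ℂ} {ξ : V} (hf : MikhlinAt l A f ξ) : 0 ≤ A :=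
  le_trans (by positivity) (hf.bound 0 (Nat.zero_le _))

theorem mul {l : ℕ} {A B : ℝ} {f g : V → ℂ} {ξ : V} (hf : MikhlinAt l A f ξ)
    (hg : MikhlinAt l B g ξ) : MikhlinAt l (2 ^ l * (A * B)) (fun x => f x * g x) ξ := by
  refine ⟨hf.contDiffAt.mul hg.contDiffAt, fun k hk => ?_⟩
  have hA := hf.nonneg
  have hB := hg.nonneg
  obtain ⟨U, hU, hξ, hc⟩ := hf.contDiffAt.exists_isOpen
  obtain ⟨U', hU', hξ', hc'⟩ := hg.contDiffAt.exists_isOpen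
  have hO := hU.inter hU'
  have e := norm_iteratedFDerivWithin_mul_le (hc.mono Set.inter_subset_left)
    (hc'.mono Set.inter_subset_right) hO.uniqueDiffOn ⟨hξ, hξ'⟩ (n := k) (by exact_mod_cast hk)
  simp only [fun n (f : V → ℂ) => iteratedFDerivWithin_of_isOpen (𝕜 := ℝ) (f := f) n hO
    (⟨hξ, hξ'⟩ : ξ ∈ U ∩ U')] at e
  calc ‖ξ‖ ^ k * ‖iteratedFDeriv ℝ k (fun x => f x * g x) ξ‖
      ≤ ‖ξ‖ ^ k * ∑ i ∈ Finset.range (k + 1), (k.choose i : ℝ) * ‖iteratedFDeriv ℝ i f ξ‖ *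
        ‖iteratedFDeriv ℝ (k - i) g ξ‖ := by gcongr
    _ = ∑ i ∈ Finset.range (k + 1), (k.choose i : ℝ) * ((‖ξ‖ ^ i * ‖iteratedFDeriv ℝ i f ξ‖) *
        (‖ξ‖ ^ (k - i) * ‖iteratedFDeriv ℝ (k - i) g ξ‖)) := by
      rw [Finset.mul_sum]
      refine Finset.sum_congr rfl fun i hi => ?_
      rw [← pow_mul_pow_sub ‖ξ‖ (Nat.lt_succ_iff.1 (Finset.mem_range.1 hi))]
      ring
    _ ≤ ∑ i ∈ Finset.range (k + 1), (k.choose i : ℝ) * (A * B) := by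
      refine Finset.sum_le_sum fun i hi => ?_
      have hik := Nat.lt_succ_iff.1 (Finset.mem_range.1 hi)
      have h1 := hf.bound i (hik.trans hk)
      have h2 := hg.bound (k - i) ((Nat.sub_le _ _).trans hk)
      gcongr
    _ = 2 ^ k * (A * B) := by
      rw [← Finset.sum_mul]
      congr 1
      exact_mod_cast Nat.sum_range_choose k
    _ ≤ 2 ^ l * (A * B) := by
      gcongr
      norm_num

/-- One factor `c` per derivative comes from the chain rule, the other from trading `‖ζ‖` for `‖g
ζ‖`. The latter is possible only where `g` is bounded below, hence the cone cutoff. -/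
theorem comp_linear {l : ℕ} {A c : ℝ} {m : V → ℂ} {g : W →L[ℝ] V} {ζ : W}
    (hm : MikhlinAt l A m (g ζ)) (hc : 1 ≤ c) (hg : ‖g‖ ≤ c) (hζ : ‖ζ‖ ≤ c * ‖g ζ‖) :
    MikhlinAt l ((c * c) ^ l * A) (fun x => m (g x)) ζ := by
  refine ⟨hm.contDiffAt.comp ζ g.contDiff.contDiffAt, fun k hk => ?_⟩
  have hA := hm.nonneg
  calc ‖ζ‖ ^ k * ‖iteratedFDeriv ℝ k (fun x => m (g x)) ζ‖
      ≤ (c * ‖g ζ‖) ^ k * (‖iteratedFDeriv ℝ k m (g ζ)‖ * c ^ k) := by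
        have := norm_iteratedFDeriv_comp_right_le hk g hm.contDiffAt
        gcongr
        exact this.trans (by gcongr)
    _ = (c * c) ^ k * (‖g ζ‖ ^ k * ‖iteratedFDeriv ℝ k m (g ζ)‖) := by rw [mul_pow, mul_pow]; ring
    _ ≤ (c * c) ^ l * A := by
        gcongr
        · nlinarith
        · exact hm.bound k hk

/-- The constant is unchanged, which makes the bounds for the dilated cutoffs uniform in the scale.
-/
theorem comp_smul {l : ℕ} {A t : ℝ} (ht : 0 < t) {m : V → ℂ} {ζ : V}
    (hm : MikhlinAt l A m (t • ζ)) : MikhlinAt l A (fun x => m (t • x)) ζ := by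
  let g : V →L[ℝ] V := t • ContinuousLinearMap.id ℝ V
  have hgn : ‖g‖ ≤ t := by
    refine (norm_smul_le t (ContinuousLinearMap.id ℝ V)).trans ?_
    rw [Real.norm_of_nonneg ht.le]
    exact mul_le_of_le_one_right ht.le ContinuousLinearMap.norm_id_le
  refine ⟨ContDiffAt.comp (g := m) (f := g) ζ hm.contDiffAt g.contDiff.contDiffAt,
    fun k hk => ?_⟩
  have h1 := norm_iteratedFDeriv_comp_right_le (g := g) hk hm.contDiffAt
  calc ‖ζ‖ ^ k * ‖iteratedFDeriv ℝ k (fun x => m (t • x)) ζ‖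
      ≤ ‖ζ‖ ^ k * (‖iteratedFDeriv ℝ k m (t • ζ)‖ * t ^ k) := by
        gcongr
        exact h1.trans (by gcongr; exact le_rfl)
    _ = ‖t • ζ‖ ^ k * ‖iteratedFDeriv ℝ k m (t • ζ)‖ := by
        rw [norm_smul, Real.norm_of_nonneg ht.le, mul_pow]; ring
    _ ≤ A := hm.bound k hk

theorem mono {l : ℕ} {A B : ℝ} (h : A ≤ B) {m : V → ℂ} {ζ : V} (hm : MikhlinAt l A m ζ) :
    MikhlinAt l B m ζ := ⟨hm.contDiffAt, fun k hk => (hm.bound k hk).trans h⟩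

theorem of_eventually_eq_zero {l : ℕ} {m : V → ℂ} {ζ : V} (hm : m =ᶠ[nhds ζ] fun _ => 0) :
    MikhlinAt l 0 m ζ := by
  refine ⟨contDiffAt_const.congr_of_eventuallyEq hm, fun k _ => ?_⟩
  rw [(Filter.EventuallyEq.iteratedFDeriv ℝ hm k).eq_of_nhds, iteratedFDeriv_fun_zero]
  simp

theorem const_mul {l : ℕ} {A : ℝ} {m : V → ℂ} {ζ : V} (hm : MikhlinAt l A m ζ) (c : ℂ) :
    MikhlinAt l (‖c‖ * A) (fun x => c * m x) ζ := by
  refine ⟨contDiffAt_const.mul hm.contDiffAt, fun k hk => ?_⟩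
  have : iteratedFDeriv ℝ k (fun x => c * m x) ζ = c • iteratedFDeriv ℝ k m ζ :=
    iteratedFDeriv_const_smul_apply (a := c) (hm.contDiffAt.of_le (by exact_mod_cast hk))
  rw [this, norm_smul, mul_left_comm]
  exact mul_le_mul_of_nonneg_left (hm.bound k hk) (norm_nonneg _)

end MikhlinAt

/-- These are the Schwartz seminorms whose weight exponent equals the order of the derivative. -/
theorem SchwartzMap.exists_mikhlinAt (χ : 𝓢(V, ℂ)) (l : ℕ) : ∃ B, ∀ ξ, MikhlinAt l B χ ξ := by
  choose A hA0 hA using fun k => χ.decay k k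
  refine ⟨∑ k ∈ Finset.range (l + 1), A k, fun ξ => ⟨(χ.smooth ⊤).contDiffAt.of_le
    (by exact_mod_cast le_top), fun k hk => (hA k ξ).trans ?_⟩⟩
  exact Finset.single_le_sum (f := A) (fun i _ => (hA0 i).le)
    (Finset.mem_range.2 (Nat.lt_succ_of_le hk))

/-- Smooth homogeneous functions of degree zero satisfy the Mikhlin bounds. -/
theorem exists_mikhlinAt_of_homogeneous [FiniteDimensional ℝ V] {θ : V → ℂ} (l : ℕ)
    (hθ : ContDiffOn ℝ l θ {0}ᶜ) (hh : ∀ t : ℝ, 0 < t → ∀ ξ, θ (t • ξ) = θ ξ) :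
    ∃ B, 0 ≤ B ∧ ∀ ξ ≠ 0, MikhlinAt l B θ ξ := by
  have hcd : ∀ ξ ≠ 0, ContDiffAt ℝ l θ ξ := fun ξ hξ =>
    hθ.contDiffAt (isOpen_compl_singleton.mem_nhds hξ)
  have hb : ∀ k ≤ l, ∃ B, ∀ ξ ∈ Metric.sphere (0 : V) 1, ‖iteratedFDeriv ℝ k θ ξ‖ ≤ B := by
    intro k hk
    refine (isCompact_sphere (0 : V) 1).exists_bound_of_continuousOn ?_
    intro ξ hξ
    have hξ0 : ξ ≠ 0 := by
      rintro rfl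
      simp at hξ
    exact ((hcd ξ hξ0).continuousAt_iteratedFDeriv (by exact_mod_cast hk)).continuousWithinAt
  choose! A hA using hb
  refine ⟨∑ k ∈ Finset.range (l + 1), |A k|, Finset.sum_nonneg fun _ _ => abs_nonneg _,
    fun ξ hξ => ?_⟩
  -- By homogeneity the bound at `ξ` follows from the one on the compact unit sphere.
  have ht : 0 < ‖ξ‖⁻¹ := inv_pos.2 (norm_pos_iff.2 hξ)
  have hn : ‖‖ξ‖⁻¹ • ξ‖ = 1 := by
    rw [norm_smul, norm_inv, norm_norm, inv_mul_cancel₀ (norm_ne_zero_iff.2 hξ)]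
  have h1 : MikhlinAt l (∑ k ∈ Finset.range (l + 1), |A k|) θ (‖ξ‖⁻¹ • ξ) := by
    refine ⟨hcd _ (fun h => by simp [h] at hn), fun k hk => ?_⟩
    rw [hn, one_pow, one_mul]
    refine (hA k hk _ (by simpa using hn)).trans ((le_abs_self _).trans ?_)
    exact Finset.single_le_sum (f := fun k => |A k|) (fun i _ => abs_nonneg _)
      (Finset.mem_range.2 (Nat.lt_succ_of_le hk))
  have h2 := h1.comp_smul ht
  rwa [show (fun x => θ (‖ξ‖⁻¹ • x)) = θ from funext (hh _ ht)] at h2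

end Mikhlin

/-! ### Lifting a multiplier by a cone cutoff -/

section Cone

variable {W V V' : Type*} [NormedAddCommGroup W] [InnerProductSpace ℝ W]
  [NormedAddCommGroup V] [InnerProductSpace ℝ V] [NormedAddCommGroup V'] [InnerProductSpace ℝ V']

/-- A smooth homogeneous cutoff to the cone `‖β ζ‖ ≤ ‖α ζ‖`. -/
noncomputable def coneCutoff (α : W →L[ℝ] V) (β : W →L[ℝ] V') (ζ : W) : ℂ :=
  -- The quotient is `1/2` for `‖α ζ‖ = ‖β ζ‖ ≠ 0` and `1` for `β ζ = 0 ≠ α ζ`; at a common zero it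
  -- is `0 / 0 = 0`, so the cutoff vanishes there.
  (Real.smoothTransition (2 * (‖α ζ‖ ^ 2 / (‖α ζ‖ ^ 2 + ‖β ζ‖ ^ 2)) - 1) : ℝ)

variable (α : W →L[ℝ] V) (β : W →L[ℝ] V')

theorem norm_coneCutoff_le (ζ : W) : ‖coneCutoff α β ζ‖ ≤ 1 := by
  rw [coneCutoff, Complex.norm_real, Real.norm_of_nonneg (Real.smoothTransition.nonneg _)]
  exact Real.smoothTransition.le_one _

theorem coneCutoff_eq_zero {ζ : W} (h : ‖α ζ‖ ≤ ‖β ζ‖) : coneCutoff α β ζ = 0 := by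
  rw [coneCutoff, Real.smoothTransition.zero_of_nonpos, Complex.ofReal_zero]
  have h1 : ‖α ζ‖ ^ 2 / (‖α ζ‖ ^ 2 + ‖β ζ‖ ^ 2) ≤ 1 / 2 := by
    have h2 : ‖α ζ‖ ^ 2 ≤ ‖β ζ‖ ^ 2 := by gcongr
    rcases (by positivity : 0 ≤ ‖α ζ‖ ^ 2 + ‖β ζ‖ ^ 2).eq_or_lt with h0 | h0
    · rw [← h0]; norm_num
    · rw [div_le_iff₀ h0]; linarith
  linarith

theorem coneCutoff_smul {t : ℝ} (ht : 0 < t) (ζ : W) :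
    coneCutoff α β (t • ζ) = coneCutoff α β ζ := by
  have : t ^ 2 ≠ 0 := by positivity
  simp only [coneCutoff, map_smul, norm_smul, mul_pow, ← mul_add, Real.norm_eq_abs,
    sq_abs]
  rw [mul_div_mul_left _ _ this]

variable {α β}

theorem contDiffOn_coneCutoff (h : ∀ ζ, α ζ = 0 → β ζ = 0 → ζ = 0) (l : ℕ) :
    ContDiffOn ℝ l (coneCutoff α β) {0}ᶜ := by
  intro ζ hζ
  refine ContDiffAt.contDiffWithinAt ?_
  have h0 : ‖α ζ‖ ^ 2 + ‖β ζ‖ ^ 2 ≠ 0 := by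
    intro h0
    have h1 : ‖α ζ‖ ^ 2 = 0 := by nlinarith [sq_nonneg ‖α ζ‖, sq_nonneg ‖β ζ‖]
    have h2 : ‖β ζ‖ ^ 2 = 0 := by nlinarith [sq_nonneg ‖α ζ‖, sq_nonneg ‖β ζ‖]
    exact hζ (h ζ (by simpa using h1) (by simpa using h2))
  have hα : ContDiffAt ℝ l (fun ζ => ‖α ζ‖ ^ 2) ζ := (α.contDiff.norm_sq ℝ).contDiffAt
  have hβ : ContDiffAt ℝ l (fun ζ => ‖β ζ‖ ^ 2) ζ := (β.contDiff.norm_sq ℝ).contDiffAt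
  exact Complex.ofRealCLM.contDiff.contDiffAt.comp ζ
    (Real.smoothTransition.contDiff.contDiffAt.comp ζ
      ((contDiffAt_const.mul (hα.div (hα.add hβ) h0)).sub contDiffAt_const))

variable [FiniteDimensional ℝ W] [MeasurableSpace W] [BorelSpace W]

/-- Multipliers on `V`, cut off to a cone and at a large scale, lift to integrable multipliers on
`W` with uniform bounds. -/
theorem exists_mikhlin_lift (h : ∀ ζ, α ζ = 0 → β ζ = 0 → ζ = 0) (χ : 𝓢(W, ℂ)) (l : ℕ) (A : ℝ) :
    ∃ B : ℝ, 0 < B ∧ ∀ m : V → ℂ, (∀ ξ, ‖m ξ‖ ≤ 1) → (∀ ξ ≠ 0, MikhlinAt l A m ξ) →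
      ∀ t : ℝ, 0 < t → ∀ M : W → ℂ,
        (∀ ζ, M ζ = (B⁻¹ : ℝ) * (χ (t • ζ) * (coneCutoff α β ζ * m (α ζ)))) →
        ContDiffOn ℝ l M {0}ᶜ ∧ (∀ ζ, ‖M ζ‖ ≤ 1) ∧
        (∀ k ≤ l, ∀ ζ ≠ 0, ‖iteratedFDeriv ℝ k M ζ‖ ≤ (‖ζ‖ ^ k)⁻¹) ∧ Integrable M := by
  obtain ⟨Bχ, hχ⟩ := χ.exists_mikhlinAt l
  obtain ⟨Bθ, hθ0, hθ⟩ := exists_mikhlinAt_of_homogeneous l (contDiffOn_coneCutoff h l)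
    (fun t ht ζ => coneCutoff_smul α β ht ζ)
  obtain ⟨c₀, -, hc₀⟩ := LinearMap.exists_antilipschitzWith ((α.prod β : W →L[ℝ] V × V') :
    W →ₗ[ℝ] V × V') (LinearMap.ker_eq_bot'.2 fun ζ hζ => h ζ (congrArg Prod.fst hζ)
      (congrArg Prod.snd hζ))
  have hBχ : 0 ≤ Bχ := (hχ 0).nonneg
  -- Bounds both `‖α‖` and, on the cone, the ratio `‖ζ‖ / ‖α ζ‖`.
  set c : ℝ := max 1 (max ‖α‖ c₀) with hc
  have hc1 : 1 ≤ c := le_max_left _ _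
  -- Two applications of the product rule to the three factors; the added `1` ensures positivity.
  set B : ℝ := 2 ^ l * (Bχ * (2 ^ l * (Bθ * ((c * c) ^ l * |A|)))) + 1 with hB
  have hB0 : 0 ≤ 2 ^ l * (Bχ * (2 ^ l * (Bθ * ((c * c) ^ l * |A|)))) := by positivity
  have hBpos : 0 < B := by linarith
  have hBn : ‖((B⁻¹ : ℝ) : ℂ)‖ = B⁻¹ := by
    rw [Complex.norm_real, Real.norm_of_nonneg (inv_nonneg.2 hBpos.le)]
  refine ⟨B, hBpos, fun m hm1 hm t ht M hM => ?_⟩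
  obtain rfl : M = _ := funext hM
  have key : ∀ ζ ≠ 0, MikhlinAt l 1
      (fun ζ => ((B⁻¹ : ℝ) : ℂ) * (χ (t • ζ) * (coneCutoff α β ζ * m (α ζ)))) ζ := by
    intro ζ hζ
    have h1 : MikhlinAt l (2 ^ l * (Bθ * ((c * c) ^ l * |A|)))
        (fun ζ => coneCutoff α β ζ * m (α ζ)) ζ := by
      -- The strict inequality is open, so the product vanishes near `ζ`. Otherwise, including on
      -- the boundary of the cone, `‖ζ‖` is controlled by `‖α ζ‖`.
      rcases lt_or_ge ‖α ζ‖ ‖β ζ‖ with hlt | hge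
      · refine (MikhlinAt.of_eventually_eq_zero ?_).mono (by positivity)
        filter_upwards [(isOpen_lt α.continuous.norm β.continuous.norm).mem_nhds hlt] with x hx
        rw [coneCutoff_eq_zero α β (le_of_lt hx), zero_mul]
      · have hα0 : α ζ ≠ 0 := fun h0 => hζ (h ζ h0 (by
          rw [h0, norm_zero] at hge
          exact norm_le_zero_iff.1 hge))
        have hn : ‖ζ‖ ≤ c * ‖α ζ‖ := by
          have h2 : ‖ζ‖ ≤ c₀ * max ‖α ζ‖ ‖β ζ‖ := by
            simpa [Prod.norm_def] using hc₀.le_mul_norm (map_zero _) ζ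
          rw [max_eq_left hge] at h2
          exact h2.trans (by gcongr; exact (le_max_right _ _).trans (le_max_right _ _))
        exact (hθ ζ hζ).mul (((hm _ hα0).mono (le_abs_self A)).comp_linear hc1
          ((le_max_left _ _).trans (le_max_right _ _)) hn)
    refine ((((hχ (t • ζ)).comp_smul ht).mul h1).const_mul _).mono ?_
    rw [hBn, inv_mul_le_iff₀ hBpos]
    linarith
  have hcd : ContDiffOn ℝ l
      (fun ζ => ((B⁻¹ : ℝ) : ℂ) * (χ (t • ζ) * (coneCutoff α β ζ * m (α ζ)))) {0}ᶜ :=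
    fun ζ hζ => (key ζ hζ).contDiffAt.contDiffWithinAt
  refine ⟨hcd, fun ζ => ?_, fun k hk ζ hζ => ?_, ?_⟩
  · by_cases hζ : ζ = 0
    · subst hζ
      simp [coneCutoff_eq_zero α β (ζ := 0) (by simp)]
    · simpa using (key ζ hζ).bound 0 (Nat.zero_le _)
  · rw [← mul_one (‖ζ‖ ^ k)⁻¹, le_inv_mul_iff₀ (pow_pos (norm_pos_iff.2 hζ) k)]
    exact (key ζ hζ).bound k hk
  · have hi : Integrable fun ζ => ((B⁻¹ : ℝ) : ℂ) * χ (t • ζ) :=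
      (χ.integrable.comp_smul ht.ne').const_mul _
    refine hi.mono (measurable_of_continuousOn_compl_singleton 0
      hcd.continuousOn).aestronglyMeasurable (Filter.Eventually.of_forall fun ζ => ?_)
    rw [← mul_assoc, norm_mul]
    refine mul_le_of_le_one_right (norm_nonneg _) ?_
    rw [norm_mul]
    exact mul_le_one₀ (norm_coneCutoff_le α β ζ) (norm_nonneg _) (hm1 _)

end Cone

/-! ### Haar measures and norms under linear maps and dilations -/

section Measure

variable {X Y : Type*} [NormedAddCommGroup X] [NormedSpace ℝ X]
  [MeasurableSpace X] [BorelSpace X] [NormedAddCommGroup Y] [NormedSpace ℝ Y]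
  [FiniteDimensional ℝ Y] [MeasurableSpace Y] [BorelSpace Y]

theorem ContinuousLinearEquiv.exists_eq_smul_map (e : X ≃L[ℝ] Y) (μ : Measure X)
    [μ.IsAddHaarMeasure] (ν : Measure Y) [ν.IsAddHaarMeasure] :
    ∃ c : ℝ≥0, c ≠ 0 ∧ ν = c • μ.map e := by
  have := e.isAddHaarMeasure_map μ
  refine ⟨Measure.addHaarScalarFactor ν (μ.map e),
    (Measure.addHaarScalarFactor_pos_of_isAddHaarMeasure _ _).ne',
    Measure.isAddLeftInvariant_eq_smul _ _⟩

theorem ContinuousLinearEquiv.exists_integral_eq (e : X ≃L[ℝ] Y) (μ : Measure X)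
    [μ.IsAddHaarMeasure] (ν : Measure Y) [ν.IsAddHaarMeasure] :
    ∃ c : ℝ, 0 < c ∧ ∀ h : Y → ℂ, ∫ y, h y ∂ν = c * ∫ x, h (e x) ∂μ := by
  obtain ⟨c, h0, rfl⟩ := e.exists_eq_smul_map μ ν
  refine ⟨c, by positivity, fun h => ?_⟩
  have e1 : ∫ y, h y ∂(μ.map e) = ∫ x, h (e x) ∂μ :=
    e.toHomeomorph.measurableEmbedding.integral_map (μ := μ) h
  rw [integral_smul_nnreal_measure, e1]
  rfl

theorem ContinuousLinearEquiv.exists_eLpNorm_le (e : X ≃L[ℝ] Y) (μ : Measure X)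
    [μ.IsAddHaarMeasure] (ν : Measure Y) [ν.IsAddHaarMeasure] (p : ℝ≥0∞) (hp : p ≠ ∞) :
    ∃ c : ℝ≥0, ∀ h : Y → ℂ, eLpNorm h p ν ≤ c * eLpNorm (fun x => h (e x)) p μ := by
  obtain ⟨c, h0, rfl⟩ := e.exists_eq_smul_map μ ν
  refine ⟨c ^ p.toReal⁻¹, fun h => ?_⟩
  have e1 : eLpNorm h p (μ.map e) = eLpNorm (fun x => h (e x)) p μ :=
    e.toHomeomorph.measurableEmbedding.eLpNorm_map_measure (μ := μ) (g := h)
  rw [eLpNorm_smul_measure_of_ne_top' hp, ENNReal.smul_def, smul_eq_mul, e1]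

theorem eLpNorm_prod_mul {X Y : Type*} [MeasurableSpace X] [MeasurableSpace Y] {μ : Measure X} {ν : Measure Y} [SFinite μ] [SFinite ν] {f : X → ℂ}
    {g : Y → ℂ} (hf : AEStronglyMeasurable f μ) (hg : AEStronglyMeasurable g ν) {p : ℝ≥0∞}
    (h0 : p ≠ 0) (ht : p ≠ ∞) :
    eLpNorm (fun q : X × Y => f q.1 * g q.2) p (μ.prod ν) = eLpNorm f p μ * eLpNorm g p ν := by
  simp only [eLpNorm_eq_lintegral_rpow_enorm_toReal h0 ht]
  rw [← ENNReal.mul_rpow_of_nonneg _ _ (by positivity), ← lintegral_prod_mul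
    (hf.enorm.pow_const _) (hg.enorm.pow_const _)]
  congr 2
  ext q
  rw [enorm_mul, ENNReal.mul_rpow_of_nonneg _ _ (by positivity)]

theorem eLpNorm_comp_inv_smul [FiniteDimensional ℝ X] (μ : Measure X) [μ.IsAddHaarMeasure] (g : X → ℂ) {p : ℝ≥0∞}
    (ht : p ≠ ∞) {t : ℝ} (h : 0 < t) :
    eLpNorm (fun x => g (t⁻¹ • x)) p μ =
      ENNReal.ofReal (t ^ ((Module.finrank ℝ X : ℝ) / p.toReal)) * eLpNorm g p μ := by
  have e1 : eLpNorm (fun x => g (t⁻¹ • x)) p μ =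
      eLpNorm g p (μ.map fun x => t⁻¹ • x) :=
    ((Homeomorph.smulOfNeZero t⁻¹ (inv_ne_zero h.ne')).measurableEmbedding.eLpNorm_map_measure
      (μ := μ) (g := g)).symm
  rw [e1, Measure.map_addHaar_smul μ (inv_ne_zero h.ne'),
    eLpNorm_smul_measure_of_ne_top ht, smul_eq_mul]
  congr 1
  rw [inv_pow, inv_inv, abs_of_pos (by positivity),
    ENNReal.ofReal_rpow_of_pos (by positivity), ← Real.rpow_natCast, ← Real.rpow_mul h.le,
    ENNReal.toReal_div, ENNReal.toReal_one, mul_one_div]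

theorem integral_prod_comp_smul {X : Type*} [TopologicalSpace X] [MeasurableSpace X]
    [BorelSpace X] [SecondCountableTopology X] (μ : Measure X) [SFinite μ] (ν : Measure Y)
    [ν.IsAddHaarMeasure] (h : X × Y → ℂ) {t : ℝ} (ht : 0 < t) :
    ∫ q, h (q.1, t • q.2) ∂(μ.prod ν) =
      ((t ^ Module.finrank ℝ Y)⁻¹ : ℝ) * ∫ q, h q ∂(μ.prod ν) := by
  let e := Homeomorph.smulOfNeZero (α := Y) t ht.ne'
  have e1 := ((Homeomorph.refl X).prodCongr e).measurableEmbedding.integral_map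
    (μ := μ.prod ν) h
  have e2 : (μ.prod ν).map ((Homeomorph.refl X).prodCongr e) =
      ENNReal.ofReal (t ^ Module.finrank ℝ Y)⁻¹ • μ.prod ν := by
    have e3 := Measure.map_prod_map μ ν measurable_id (f := (id : X → X)) e.continuous.measurable
    rw [show (e : Y → Y) = fun y => t • y from rfl, Measure.map_addHaar_smul ν ht.ne', Measure.map_id,
      Measure.prod_smul_right, abs_of_pos (by positivity)] at e3
    exact e3.symm
  rw [e2, integral_smul_measure, ENNReal.toReal_ofReal (by positivity)] at e1
  exact e1.symm.trans (by simp)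

end Measure

/-! ### Approximation by dilated lifts -/

section Multiplier

/-- The multipliers for which there is a Calderón–Zygmund kernel by `exists_isCZKernel`. -/
structure IsCZMultiplier {V : Type*} [NormedAddCommGroup V] [InnerProductSpace ℝ V]
    [FiniteDimensional ℝ V] [MeasurableSpace V] [BorelSpace V] (l : ℕ) (m : V → ℂ) : Prop where
  contDiffOn : ContDiffOn ℝ l m {0}ᶜ
  norm_le : ∀ ξ, ‖m ξ‖ ≤ 1
  bound : ∀ k ≤ l, ∀ ξ ≠ 0, ‖iteratedFDeriv ℝ k m ξ‖ ≤ (‖ξ‖ ^ k)⁻¹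
  integrable_or_const : Integrable m ∨ ∃ c, m = fun _ => c

theorem isCZMultiplier_const {V : Type*} [NormedAddCommGroup V] [InnerProductSpace ℝ V]
    [FiniteDimensional ℝ V] [MeasurableSpace V] [BorelSpace V] (l : ℕ) {c : ℂ} (hc : ‖c‖ ≤ 1) :
    IsCZMultiplier l (fun _ : V => c) := by
  refine ⟨contDiffOn_const, fun _ => hc, fun k _ ξ _ => ?_, Or.inr ⟨c, rfl⟩⟩
  rcases Nat.eq_zero_or_pos k with rfl | hk
  · simpa using hc
  · rw [iteratedFDeriv_const_of_ne hk.ne']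
    simp

variable {V V' W : Type*} [NormedAddCommGroup V] [InnerProductSpace ℝ V] [FiniteDimensional ℝ V]
  [MeasurableSpace V] [BorelSpace V] [NormedAddCommGroup V'] [InnerProductSpace ℝ V']
  [FiniteDimensional ℝ V'] [MeasurableSpace V'] [BorelSpace V'] [NormedAddCommGroup W]
  [InnerProductSpace ℝ W] [FiniteDimensional ℝ W] [MeasurableSpace W] [BorelSpace W]

/-- Multipliers on `V` are limits of dilated multipliers on `V × V'`. -/
theorem exists_isCZMultiplier_tendsto (Ψ : (V × V') ≃L[ℝ] W) (l : ℕ) (A : ℝ) :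
    ∃ B : ℝ, 0 < B ∧ ∀ m : V → ℂ, (∀ ξ, ‖m ξ‖ ≤ 1) → (∀ ξ ≠ 0, MikhlinAt l A m ξ) →
      ∃ M : ℕ → W → ℂ, (∀ n, IsCZMultiplier l (M n)) ∧
        ∀ᵐ q : V × V', Filter.Tendsto (fun n : ℕ => M n (Ψ (q.1, ((n : ℝ) + 1)⁻¹ • q.2)))
          Filter.atTop (nhds ((B⁻¹ : ℝ) * m q.1)) := by
  -- If `V = 0` the cone cutoff vanishes identically, but `m` is constant and lifts to a constant.
  rcases subsingleton_or_nontrivial V with hV | hV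
  · refine ⟨1, one_pos, fun m hm _ => ⟨fun _ _ => m 0, fun n => isCZMultiplier_const l (hm 0),
      Filter.Eventually.of_forall fun q => ?_⟩⟩
    rw [Subsingleton.elim q.1 0]
    simp
  · let α : W →L[ℝ] V := (ContinuousLinearMap.fst ℝ V V').comp Ψ.symm.toContinuousLinearMap
    let β : W →L[ℝ] V' := (ContinuousLinearMap.snd ℝ V V').comp Ψ.symm.toContinuousLinearMap
    have hα : ∀ q, α (Ψ q) = q.1 := fun q => by simp [α]
    have hβ : ∀ q, β (Ψ q) = q.2 := fun q => by simp [β]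
    have hinj : ∀ ζ, α ζ = 0 → β ζ = 0 → ζ = 0 := by
      intro ζ h1 h2
      obtain ⟨q, rfl⟩ := Ψ.surjective ζ
      rw [hα] at h1
      rw [hβ] at h2
      rw [show q = 0 from Prod.ext h1 h2, map_zero]
    obtain ⟨χ, ρ, hρc, hχρ, -, hρ1⟩ := SchwartzMap.exists_bump W
    obtain ⟨B, hB, h⟩ := exists_mikhlin_lift hinj χ l A
    refine ⟨B, hB, fun m hm1 hm => ⟨fun n ζ => (B⁻¹ : ℝ) *
      (χ (((n : ℝ) + 1)⁻¹ • ζ) * (coneCutoff α β ζ * m (α ζ))), fun n => ?_, ?_⟩⟩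
    · obtain ⟨h1, h2, h3, h4⟩ := h m hm1 hm ((n : ℝ) + 1)⁻¹ (by positivity) _ fun ζ => rfl
      exact ⟨h1, h2, h3, Or.inl h4⟩
    · have hae : ∀ᵐ q : V × V', q.1 ≠ 0 :=
        Measure.quasiMeasurePreserving_fst.ae (p := fun x : V => x ≠ 0)
          (compl_mem_ae_iff.2 (measure_singleton 0))
      filter_upwards [hae] with q hq
      have ht : Filter.Tendsto (fun n : ℕ => ((n : ℝ) + 1)⁻¹) Filter.atTop (nhds 0) := by
        simpa [one_div] using tendsto_one_div_add_atTop_nhds_zero_nat (𝕜 := ℝ)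
      have h2 : Filter.Tendsto (fun n : ℕ => ((n : ℝ) + 1)⁻¹ • q.2) Filter.atTop (nhds 0) := by
        simpa using ht.smul_const q.2
      have h3 : Filter.Tendsto (fun n : ℕ => Ψ (q.1, ((n : ℝ) + 1)⁻¹ • q.2)) Filter.atTop
          (nhds (Ψ (q.1, 0))) :=
        (Ψ.continuous.tendsto _).comp (tendsto_const_nhds.prodMk_nhds h2)
      have h4 : Filter.Tendsto (fun n : ℕ => χ (((n : ℝ) + 1)⁻¹ • Ψ (q.1, ((n : ℝ) + 1)⁻¹ • q.2)))
          Filter.atTop (nhds 1) := by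
        have := (χ.continuous.tendsto _).comp (ht.smul h3)
        rwa [zero_smul, hχρ, hρ1, Complex.ofReal_one] at this
      -- The points converge to `Ψ (q.1, 0)`, on the axis of the cone, where the cutoff is `1`.
      have h5 : Filter.Tendsto (fun n : ℕ => coneCutoff α β (Ψ (q.1, ((n : ℝ) + 1)⁻¹ • q.2)))
          Filter.atTop (nhds 1) := by
        have h6 : ContinuousAt (coneCutoff α β) (Ψ (q.1, 0)) := by
          refine ((contDiffOn_coneCutoff hinj 0).continuousOn.continuousAt
            (isOpen_compl_singleton.mem_nhds ?_))
          rw [Set.mem_compl_iff, Set.mem_singleton_iff, map_eq_zero_iff Ψ Ψ.injective]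
          exact fun h0 => hq (congrArg Prod.fst h0)
        have h7 : coneCutoff α β (Ψ (q.1, 0)) = 1 := by
          have h8 : ‖q.1‖ ^ 2 ≠ 0 := by simpa using hq
          rw [coneCutoff, hα, hβ]
          simp only [norm_zero, ne_eq, OfNat.ofNat_ne_zero, not_false_eq_true, zero_pow, add_zero]
          rw [div_self h8, Real.smoothTransition.one_of_one_le (by norm_num), Complex.ofReal_one]
        rw [← h7]
        exact h6.tendsto.comp h3
      have h9 := ((h4.mul (h5.mul_const (m q.1))).const_mul ((B⁻¹ : ℝ) : ℂ))
      simpa only [hα, one_mul] using h9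

end Multiplier

/-! ### The forms on the Fourier side -/

/-- A linear equivalence has an inverse adjoint with respect to the inner product of a direct
sum. -/
theorem ContinuousLinearEquiv.exists_inner_prod {S S' T : Type*} [NormedAddCommGroup S]
    [InnerProductSpace ℝ S] [FiniteDimensional ℝ S] [NormedAddCommGroup S']
    [InnerProductSpace ℝ S'] [FiniteDimensional ℝ S'] [NormedAddCommGroup T]
    [InnerProductSpace ℝ T] [FiniteDimensional ℝ T] (e : (S × S') ≃L[ℝ] T) :
    ∃ Ψ : (S × S') ≃L[ℝ] T, ∀ s q,
      inner ℝ (e s) (Ψ q) = inner ℝ s.1 q.1 + inner ℝ s.2 q.2 := by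
  let a : S →ₗ[ℝ] T := e.toLinearMap ∘ₗ LinearMap.inl ℝ S S'
  let b : S' →ₗ[ℝ] T := e.toLinearMap ∘ₗ LinearMap.inr ℝ S S'
  let L : T →ₗ[ℝ] S × S' := a.adjoint.prod b.adjoint
  have hL : ∀ s ζ, inner ℝ s.1 (L ζ).1 + inner ℝ s.2 (L ζ).2 = inner ℝ (e s) ζ := by
    intro s ζ
    have h1 : inner ℝ s.1 (L ζ).1 = inner ℝ (a s.1) ζ := LinearMap.adjoint_inner_right _ _ _
    have h2 : inner ℝ s.2 (L ζ).2 = inner ℝ (b s.2) ζ := LinearMap.adjoint_inner_right _ _ _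
    have h3 : e s = a s.1 + b s.2 := by
      change e s = e (s.1, 0) + e (0, s.2)
      rw [← map_add]
      simp
    rw [h1, h2, h3, inner_add_left]
  have hinj : Function.Injective L := by
    rw [← LinearMap.ker_eq_bot, LinearMap.ker_eq_bot']
    intro ζ hζ
    have h := hL (e.symm ζ) ζ
    rw [hζ, e.apply_symm_apply] at h
    simpa using h.symm
  let Λ := L.linearEquivOfInjective hinj e.toLinearEquiv.finrank_eq.symm
  refine ⟨Λ.symm.toContinuousLinearEquiv, fun s q => ?_⟩
  have h := hL s (Λ.symm q)
  rw [show L (Λ.symm q) = q from Λ.apply_symm_apply q] at h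
  exact h.symm

namespace BLDatum

/-- `g` is the inverse Fourier transform of the fibre integral of the product of the `f i`. -/
def IsFourierFiber (D : BLDatum.{u}) (f : ∀ i : Fin 3, 𝓢(D.S i.succ, ℂ)) (g : 𝓢(D.S 0, ℂ)) :
    Prop :=
  ∀ ξ, g ξ = ∫ x, Real.fourierChar (inner ℝ (D.Pr 0 x) ξ) • D.tensor f x

/-- The maps `Pr 1, Pr 2, Pr 3` are jointly injective. -/
def IsJointlyInjective (D : BLDatum.{u}) : Prop :=
  ∀ v : D.H, (∀ i : Fin 3, D.Pr i.succ v = 0) → v = 0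

/-- The integrand is the restriction of a Schwartz tensor product along an injective linear map,
hence Schwartz, and so is its fibre integral. -/
theorem IsJointlyInjective.exists_isFourierFiber {D : BLDatum.{u}} (h : D.IsJointlyInjective)
    (f : ∀ i : Fin 3, 𝓢(D.S i.succ, ℂ)) :
    ∃ g, D.IsFourierFiber f g ∧ D.IsFiberIntegral f (𝓕 g) := by
  let P : ∀ i, D.H →L[ℝ] D.S i := fun i => (D.Pr i).toContinuousLinearMap
  let L := (P (Fin.succ 0)).prod ((P (Fin.succ 1)).prod (P (Fin.succ 2)))
  have hL : Function.Injective L := by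
    rw [← ContinuousLinearMap.coe_coe, ← LinearMap.ker_eq_bot, LinearMap.ker_eq_bot']
    intro v hv
    refine h v fun i => ?_
    have h1 := congrArg Prod.fst hv
    have h2 := congrArg (fun q => q.2.1) hv
    have h3 := congrArg (fun q => q.2.2) hv
    fin_cases i
    · exact h1
    · exact h2
    · exact h3
  obtain ⟨F, hF⟩ := (f 0).exists_mul_comp ((f 1).tensorProd (f 2)) L hL
  have hF' : ∀ x, F x = D.tensor f x := by
    intro x
    rw [hF, tensor, Fin.prod_univ_three, mul_assoc]
    rfl
  obtain ⟨G, hG, hG'⟩ := F.exists_fiberIntegral (P 0) (D.surj 0)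
  refine ⟨𝓕⁻ G, fun ξ => ?_, fun φ => ?_⟩
  · rw [hG, SchwartzMap.fourierInv_coe, Real.fourierInv_eq]
    refine integral_congr_ae (Filter.Eventually.of_forall fun x => ?_)
    simp only
    rw [ContinuousLinearMap.adjoint_inner_right, hF']
    rfl
  · rw [FourierTransform.fourier_fourierInv_eq G]
    have := hG' φ
    simp only [hF'] at this
    exact this

theorem IsFourierFiber.isFiberIntegral {D : BLDatum.{u}} (h : D.IsJointlyInjective)
    {f : ∀ i : Fin 3, 𝓢(D.S i.succ, ℂ)} {g : 𝓢(D.S 0, ℂ)} (hg : D.IsFourierFiber f g) :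
    D.IsFiberIntegral f (𝓕 g) := by
  obtain ⟨g', hg', h'⟩ := h.exists_isFourierFiber f
  rwa [show g = g' by ext ξ; rw [hg, hg']]

theorem IsFourierFiber.eq_of_hasForm {D : BLDatum.{u}} (h : D.IsJointlyInjective)
    {f : ∀ i : Fin 3, 𝓢(D.S i.succ, ℂ)} {g : 𝓢(D.S 0, ℂ)} (hg : D.IsFourierFiber f g)
    {K : 𝓢'(D.S 0, ℂ)} {z : ℂ} (hz : D.HasForm K f z) : z = (𝓕 K) g := by
  obtain ⟨G, hG, rfl⟩ := hz
  rw [hG.unique (hg.isFiberIntegral h)]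
  rfl

/-- There are test functions whose fibre integral does not vanish at the origin. -/
theorem IsJointlyInjective.exists_integral_ne_zero {D : BLDatum.{u}}
    (h : D.IsJointlyInjective) : ∃ f g, D.IsFourierFiber f g ∧ ∫ ξ, g ξ ≠ 0 := by
  choose f ρ hρc hfρ hρ0 hρ1 using fun i : Fin 3 => SchwartzMap.exists_bump (D.S i.succ)
  obtain ⟨φ, σ, hσc, hφσ, hσ0, hσ1⟩ := SchwartzMap.exists_bump (D.S 0)
  obtain ⟨g, hg, hG⟩ := h.exists_isFourierFiber f
  have hcont : ∀ i, Continuous (D.Pr i) := fun i => (D.Pr i).continuous_of_finiteDimensional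
  have hne : ∫ x, D.tensor f x * φ (D.Pr 0 x) ≠ 0 := by
    refine integral_ne_zero_of_eq_ofReal (x₀ := (0 : D.H)) (r := fun x =>
      (∏ i : Fin 3, ρ i (D.Pr i.succ x)) * σ (D.Pr 0 x))
      ((continuous_finsetProd _ fun i _ => (hρc i).comp (hcont _)).mul (hσc.comp (hcont 0)))
      (fun x => ?_) (hG φ).1 (fun x => ?_) ?_
    · simp [tensor, hfρ, hφσ]
    · exact mul_nonneg (Finset.prod_nonneg fun i _ => hρ0 _ _) (hσ0 _)
    · simp [hρ1, hσ1]
  -- As `∫ g = (𝓕 g) 0`, it suffices to translate the `f i` so that a point where the fibre integral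
  -- is nonzero moves to the origin.
  obtain ⟨t, ht⟩ : ∃ t, (𝓕 g) t ≠ 0 := by
    by_contra! h0
    exact hne ((hG φ).2.trans (by simp [h0]))
  obtain ⟨y, rfl⟩ := D.surj 0 t
  let f' : ∀ i : Fin 3, 𝓢(D.S i.succ, ℂ) := fun i =>
    SchwartzMap.compSubConstCLM ℂ (-(D.Pr i.succ y)) (f i)
  have hf' : ∀ x, D.tensor f' x = D.tensor f (x + y) := fun x => by
    simp [tensor, f', SchwartzMap.compSubConstCLM_apply]
  obtain ⟨g', hg', hG'⟩ := h.exists_isFourierFiber f'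
  have hT : D.IsFiberIntegral f' (SchwartzMap.compSubConstCLM ℂ (-(D.Pr 0 y)) (𝓕 g)) := by
    intro ψ
    obtain ⟨h1, h2⟩ := hG (SchwartzMap.compSubConstCLM ℂ (D.Pr 0 y) ψ)
    simp only [SchwartzMap.compSubConstCLM_apply] at h1 h2
    have e1 : ∀ x, D.tensor f' x * ψ (D.Pr 0 x) =
        D.tensor f (x + y) * ψ (D.Pr 0 (x + y) - D.Pr 0 y) := fun x => by
      rw [hf', map_add, add_sub_cancel_right]
    simp only [e1, SchwartzMap.compSubConstCLM_apply, sub_neg_eq_add]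
    refine ⟨h1.comp_add_right y, ?_⟩
    rw [integral_add_right_eq_self (fun x => D.tensor f x * ψ (D.Pr 0 x - D.Pr 0 y)), h2,
      ← integral_add_right_eq_self _ (D.Pr 0 y)]
    simp only [add_sub_cancel_right]
  refine ⟨f', g', hg', ?_⟩
  have e2 : ∫ ξ, g' ξ = (𝓕 g') 0 := by
    rw [SchwartzMap.fourier_coe, Real.fourier_eq]
    simp
  rw [e2, hG'.unique hT]
  simpa [SchwartzMap.compSubConstCLM_apply] using ht

theorem IsFourierFiber.exists_dilate {D : BLDatum.{u}} {f : ∀ i : Fin 3, 𝓢(D.S i.succ, ℂ)}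
    {g : 𝓢(D.S 0, ℂ)} (hg : D.IsFourierFiber f g) {t : ℝ} (ht : 0 < t) :
    ∃ f' g', D.IsFourierFiber f' g' ∧ (∀ i s, f' i s = f i (t⁻¹ • s)) ∧
      ∀ ξ, g' ξ = (t ^ Module.finrank ℝ D.H : ℝ) * g (t • ξ) := by
  have ht0 : t⁻¹ ≠ 0 := inv_ne_zero ht.ne'
  let f' : ∀ i : Fin 3, 𝓢(D.S i.succ, ℂ) := fun i => SchwartzMap.compCLMOfContinuousLinearEquiv ℂ
    (ContinuousLinearEquiv.smulLeft (Units.mk0 t⁻¹ ht0)) (f i)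
  let g' : 𝓢(D.S 0, ℂ) := ((t ^ Module.finrank ℝ D.H : ℝ) : ℂ) •
    SchwartzMap.compCLMOfContinuousLinearEquiv ℂ
      (ContinuousLinearEquiv.smulLeft (Units.mk0 t ht.ne')) g
  have hf' : ∀ i s, f' i s = f i (t⁻¹ • s) := fun i s => rfl
  have hg' : ∀ ξ, g' ξ = (t ^ Module.finrank ℝ D.H : ℝ) * g (t • ξ) := fun ξ => rfl
  refine ⟨f', g', fun ξ => ?_, hf', hg'⟩
  have h1 : ∀ x, Real.fourierChar (inner ℝ (D.Pr 0 x) ξ) • D.tensor f' x =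
      Real.fourierChar (inner ℝ (D.Pr 0 (t⁻¹ • x)) (t • ξ)) • D.tensor f (t⁻¹ • x) := by
    intro x
    rw [map_smul, real_inner_smul_left, real_inner_smul_right, inv_mul_cancel_left₀ ht.ne']
    simp [tensor, hf']
  simp only [h1]
  rw [Measure.integral_comp_inv_smul_of_nonneg volume
    (fun x => Real.fourierChar (inner ℝ (D.Pr 0 x) (t • ξ)) • D.tensor f x) ht.le, hg', hg]
  simp

/-- The multilinear forms of a direct sum split on the Fourier side. -/
theorem exists_split_isFourierFiber {E : BLDatum.{x}} {D : BLDatum.{w}} {D' : BLDatum.{v}}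
    (Φ : (D.H × D'.H) ≃L[ℝ] E.H) (Θ : ∀ i, (D.S i × D'.S i) ≃L[ℝ] E.S i)
    (hΦ : ∀ i u v, E.Pr i (Φ (u, v)) = Θ i (D.Pr i u, D'.Pr i v)) :
    ∃ (Ψ : (D.S 0 × D'.S 0) ≃L[ℝ] E.S 0) (c : ℝ), 0 < c ∧
      ∀ f g f' g', D.IsFourierFiber f g → D'.IsFourierFiber f' g' →
        ∃ F G, E.IsFourierFiber F G ∧ (∀ i q, F i (Θ i.succ q) = f i q.1 * f' i q.2) ∧
          ∀ q, G (Ψ q) = c * (g q.1 * g' q.2) := by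
  obtain ⟨Ψ, hΨ⟩ := (Θ 0).exists_inner_prod
  obtain ⟨c, hc, hint⟩ := Φ.exists_integral_eq (volume.prod volume) volume
  refine ⟨Ψ, c, hc, fun f g f' g' hg hg' => ?_⟩
  let F : ∀ i : Fin 3, 𝓢(E.S i.succ, ℂ) := fun i =>
    SchwartzMap.compCLMOfContinuousLinearEquiv ℂ (Θ i.succ).symm ((f i).tensorProd (f' i))
  let G : 𝓢(E.S 0, ℂ) := (c : ℂ) •
    SchwartzMap.compCLMOfContinuousLinearEquiv ℂ Ψ.symm (g.tensorProd g')
  have hF : ∀ i q, F i (Θ i.succ q) = f i q.1 * f' i q.2 := fun i q => by simp [F]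
  have hG : ∀ q, G (Ψ q) = c * (g q.1 * g' q.2) := fun q => by simp [G]
  refine ⟨F, G, fun ζ => ?_, hF, hG⟩
  obtain ⟨q, rfl⟩ := Ψ.surjective ζ
  have h1 : ∀ y : D.H × D'.H, Real.fourierChar (inner ℝ (E.Pr 0 (Φ y)) (Ψ q)) •
      E.tensor F (Φ y) = (Real.fourierChar (inner ℝ (D.Pr 0 y.1) q.1) • D.tensor f y.1) *
        (Real.fourierChar (inner ℝ (D'.Pr 0 y.2) q.2) • D'.tensor f' y.2) := by
    rintro ⟨u, v⟩
    rw [hΦ, hΨ, AddChar.map_add_eq_mul, mul_smul, smul_mul_smul_comm, ← mul_smul]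
    congr 1
    simp only [tensor, hΦ, hF, Finset.prod_mul_distrib]
  rw [hint, hG, hg, hg']
  simp only [h1]
  rw [integral_prod_mul (fun u => Real.fourierChar (inner ℝ (D.Pr 0 u) q.1) • D.tensor f u)
    fun v => Real.fourierChar (inner ℝ (D'.Pr 0 v) q.2) • D'.tensor f' v]

end BLDatum

/-! ### Testing on products and dilating one factor -/

namespace BLDatum

/-- The estimate for a direct sum, tested on tensor products of functions, one factor of which is
dilated by `t`. -/
theorem BoundedWith.exists_product_bound {E : BLDatum.{x}} {D : BLDatum.{w}} {D' : BLDatum.{v}}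
    {p : Fin 3 → ℝ≥0∞} (hp0 : ∀ i, 0 < p i) (hpt : ∀ i, p i < ∞) {l : ℕ} {C : ℝ≥0}
    (hE : E.BoundedWith p l C) (Φ : (D.H × D'.H) ≃L[ℝ] E.H)
    (Θ : ∀ i, (D.S i × D'.S i) ≃L[ℝ] E.S i)
    (hΦ : ∀ i u v, E.Pr i (Φ (u, v)) = Θ i (D.Pr i u, D'.Pr i v)) :
    ∃ (Ψ : (D.S 0 × D'.S 0) ≃L[ℝ] E.S 0) (A : ℝ≥0) (κ : ℝ), ∀ M, IsCZMultiplier l M →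
      ∀ f g f' g', D.IsFourierFiber f g → D'.IsFourierFiber f' g' → ∀ t : ℝ, 0 < t →
        ‖∫ q : D.S 0 × D'.S 0, M (Ψ (q.1, t⁻¹ • q.2)) * (g q.1 * g' q.2)‖ₑ ≤
          A * ENNReal.ofReal (t ^ κ) * ((∏ i, eLpNorm (f i) (p i) volume) *
            ∏ i, eLpNorm (f' i) (p i) volume) := by
  have hinj : E.IsJointlyInjective := fun _ hv => hE.eq_zero_of_Pr_eq_zero hv
  obtain ⟨Ψ, c, hc, hsplit⟩ := exists_split_isFourierFiber Φ Θ hΦ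
  obtain ⟨c₁, hc₁, hint⟩ := Ψ.exists_integral_eq (volume.prod volume) volume
  choose a ha using fun i : Fin 3 => (Θ i.succ).exists_eLpNorm_le (volume.prod volume) volume
    (p i) (hpt i).ne
  set s : ℕ := Module.finrank ℝ (D'.S 0)
  set n : ℕ := Module.finrank ℝ D'.H
  set σ : ℝ := ∑ i : Fin 3, (Module.finrank ℝ (D'.S i.succ) : ℝ) / (p i).toReal with hσ
  -- In the exponent, `s` comes from rescaling the frequency variable, `-n` from the Jacobian of the
  -- dilation on `D'.H`, and `σ` from the norms of the dilated functions.
  refine ⟨Ψ, (c * c₁)⁻¹.toNNReal * (C * ∏ i, a i), (s : ℝ) - n + σ,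
    fun M hM f g f' g' hg hg' t ht => ?_⟩
  obtain ⟨f'', g'', hg'', hf''t, hg''t⟩ := hg'.exists_dilate ht
  obtain ⟨F, G, hG, hF, hGΨ⟩ := hsplit f g f'' g'' hg hg''
  obtain ⟨K, hK, hKm⟩ := exists_isCZKernel hM.contDiffOn hM.norm_le hM.bound
    hM.integrable_or_const
  obtain ⟨z, hz, hzb⟩ := hE K hK F
  set I := ∫ q : D.S 0 × D'.S 0, M (Ψ (q.1, t⁻¹ • q.2)) * (g q.1 * g' q.2) with hI
  have hzI : z = ((c * c₁ * t ^ n * (t ^ s)⁻¹ : ℝ) : ℂ) * I := by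
    rw [hG.eq_of_hasForm hinj hz, hKm, hint]
    have h1 : ∀ q : D.S 0 × D'.S 0, M (Ψ q) * G (Ψ q) = ((c * t ^ n : ℝ) : ℂ) *
        (M (Ψ (q.1, t⁻¹ • t • q.2)) * (g q.1 * g' (t • q.2))) := by
      intro q
      rw [hGΨ, hg''t, inv_smul_smul₀ ht.ne']
      push_cast
      ring
    simp only [h1]
    rw [integral_const_mul, integral_prod_comp_smul volume volume
      (fun q : D.S 0 × D'.S 0 => M (Ψ (q.1, t⁻¹ • q.2)) * (g q.1 * g' q.2)) ht,
      ← Measure.volume_eq_prod, ← hI]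
    push_cast
    ring
  have hIz : ‖I‖ₑ = ENNReal.ofReal (c * c₁)⁻¹ * ENNReal.ofReal (t ^ ((s : ℝ) - n)) * ‖z‖ₑ := by
    have h2 : I = (((c * c₁)⁻¹ * t ^ ((s : ℝ) - n) : ℝ) : ℂ) * z := by
      rw [hzI, ← mul_assoc, ← Complex.ofReal_mul, Real.rpow_sub ht, Real.rpow_natCast,
        Real.rpow_natCast]
      have : (c * c₁)⁻¹ * (t ^ s / t ^ n) * (c * c₁ * t ^ n * (t ^ s)⁻¹) = 1 := by
        field_simp
      rw [this, Complex.ofReal_one, one_mul]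
    rw [h2, enorm_mul, ← ENNReal.ofReal_mul (by positivity)]
    congr 1
    rw [← ofReal_norm, Complex.norm_real, Real.norm_of_nonneg (by positivity)]
  have hFb : ∀ i, eLpNorm (F i) (p i) volume ≤ a i * ENNReal.ofReal
      (t ^ ((Module.finrank ℝ (D'.S i.succ) : ℝ) / (p i).toReal)) *
      (eLpNorm (f i) (p i) volume * eLpNorm (f' i) (p i) volume) := by
    intro i
    refine (ha i (F i)).trans (le_of_eq ?_)
    simp only [hF]
    rw [eLpNorm_prod_mul (f i).continuous.aestronglyMeasurable
      (f'' i).continuous.aestronglyMeasurable (hp0 i).ne' (hpt i).ne,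
      show (f'' i : D'.S i.succ → ℂ) = fun s => f' i (t⁻¹ • s) from funext (hf''t i),
      eLpNorm_comp_inv_smul volume (f' i) (hpt i).ne ht]
    ring
  have hprod : ∏ i : Fin 3, ENNReal.ofReal
      (t ^ ((Module.finrank ℝ (D'.S i.succ) : ℝ) / (p i).toReal)) = ENNReal.ofReal (t ^ σ) := by
    rw [← ENNReal.ofReal_prod_of_nonneg fun i _ => by positivity, hσ, Real.rpow_sum_of_pos ht]
  calc ‖I‖ₑ ≤ ENNReal.ofReal (c * c₁)⁻¹ * ENNReal.ofReal (t ^ ((s : ℝ) - n)) *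
        (C * ∏ i, (a i * ENNReal.ofReal
          (t ^ ((Module.finrank ℝ (D'.S i.succ) : ℝ) / (p i).toReal)) *
          (eLpNorm (f i) (p i) volume * eLpNorm (f' i) (p i) volume))) := by
        rw [hIz]
        gcongr
        refine hzb.trans ?_
        gcongr
        exact hFb _
    _ = _ := by
        simp only [Finset.prod_mul_distrib]
        rw [hprod, Real.rpow_add ht, ENNReal.ofReal_mul (by positivity), ENNReal.ofReal]
        push_cast
        ring

/-- If a nonzero constant is bounded by a multiple of `t ^ κ` for all `t > 0`, then `κ ≤ 0`. -/
theorem nonpos_of_enorm_le_rpow {a A : ℝ≥0∞} (ha : a ≠ 0) (hA : A ≠ ∞) {κ : ℝ}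
    (h : ∀ t : ℝ, 0 < t → a ≤ ENNReal.ofReal (t ^ κ) * A) : κ ≤ 0 := by
  by_contra! hκ
  have h1 : Filter.Tendsto (fun t : ℝ => ENNReal.ofReal (t ^ κ) * A)
      (nhdsWithin 0 (Set.Ioi 0)) (nhds 0) := by
    have h2 : Filter.Tendsto (fun t : ℝ => t ^ κ) (nhdsWithin 0 (Set.Ioi 0)) (nhds 0) := by
      have := (Real.continuousAt_rpow_const 0 κ (Or.inr hκ.le)).tendsto
      rw [Real.zero_rpow hκ.ne'] at this
      exact this.mono_left nhdsWithin_le_nhds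
    have h3 := ENNReal.Tendsto.mul_const (ENNReal.tendsto_ofReal h2) (b := A) (Or.inr hA)
    simpa using h3
  refine ha (le_zero_iff.1 (ge_of_tendsto h1 ?_))
  filter_upwards [self_mem_nhdsWithin] with t ht using h t ht

theorem prod_eLpNorm_ne_top (D : BLDatum.{u}) (f : ∀ i : Fin 3, 𝓢(D.S i.succ, ℂ))
    (p : Fin 3 → ℝ≥0∞) : ∏ i, eLpNorm (f i) (p i) volume ≠ ∞ :=
  ENNReal.prod_ne_top fun i _ => by
    have h : eLpNorm (f i) (p i) (volume : Measure (D.S i.succ)) < ∞ :=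
      SchwartzMap.eLpNorm_lt_top (f i) (p i) volume
    exact h.ne

end BLDatum

/-- The multiplier of a kernel satisfies Mikhlin bounds in operator norm. -/
theorem IsCZKernel.exists_multiplier {V : Type u} [NormedAddCommGroup V] [InnerProductSpace ℝ V]
    [FiniteDimensional ℝ V] [MeasurableSpace V] [BorelSpace V] {k l : ℕ} {K : 𝓢'(V, ℂ)}
    (hK : IsCZKernel k K) (hl : l ≤ k) : ∃ m : V → ℂ, (∀ φ : 𝓢(V, ℂ), (𝓕 K) φ = ∫ ξ, m ξ * φ ξ) ∧
      (∀ ξ, ‖m ξ‖ ≤ 1) ∧ ∀ ξ ≠ 0, MikhlinAt l (((Module.finrank ℝ V : ℝ) + 1) ^ l) m ξ := by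
  obtain ⟨-, m, hKm, hm1, hmc, hmd⟩ := hK
  refine ⟨m, hKm, hm1, fun ξ hξ => ⟨(hmc.contDiffAt (isOpen_compl_singleton.mem_nhds hξ)).of_le
    (by exact_mod_cast hl), fun n hn => ?_⟩⟩
  have hb := ContinuousMultilinearMap.opNorm_le_of_orthonormalBasis
    (stdOrthonormalBasis ℝ V) (iteratedFDeriv ℝ n m ξ)
    (by positivity : 0 ≤ (‖ξ‖ ^ n)⁻¹) fun j => hmd _ n (hn.trans hl) j ξ hξ
  have hpos : 0 < ‖ξ‖ ^ n := pow_pos (norm_pos_iff.2 hξ) n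
  have hd : (0 : ℝ) ≤ Module.finrank ℝ V := Nat.cast_nonneg _
  calc ‖ξ‖ ^ n * ‖iteratedFDeriv ℝ n m ξ‖
      ≤ ‖ξ‖ ^ n * ((Module.finrank ℝ V : ℝ) ^ n * (‖ξ‖ ^ n)⁻¹) := by gcongr
    _ = (Module.finrank ℝ V : ℝ) ^ n := by field_simp
    _ ≤ ((Module.finrank ℝ V : ℝ) + 1) ^ n := by gcongr; linarith
    _ ≤ _ := pow_le_pow_right₀ (by linarith) hn

/-- Convergence of the forms for converging multipliers. -/
theorem tendsto_integral_multiplier {V V' W : Type*} [NormedAddCommGroup V]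
    [InnerProductSpace ℝ V] [FiniteDimensional ℝ V] [MeasurableSpace V] [BorelSpace V]
    [NormedAddCommGroup V'] [InnerProductSpace ℝ V'] [FiniteDimensional ℝ V'] [MeasurableSpace V']
    [BorelSpace V'] [NormedAddCommGroup W] [InnerProductSpace ℝ W] [MeasurableSpace W]
    [BorelSpace W] {Ψ : (V × V') ≃L[ℝ] W} {L : ℕ → W → ℂ} {c : ℂ} {m : V → ℂ}
    (hL : ∀ n, ContinuousOn (L n) {0}ᶜ) (hL1 : ∀ n ζ, ‖L n ζ‖ ≤ 1)
    (hlim : ∀ᵐ q : V × V', Filter.Tendsto (fun n : ℕ => L n (Ψ (q.1, ((n : ℝ) + 1)⁻¹ • q.2)))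
      Filter.atTop (nhds (c * m q.1))) {g : V → ℂ} {g' : V' → ℂ} (hg : Integrable g)
    (hg' : Integrable g') :
    Filter.Tendsto (fun n : ℕ => ∫ q : V × V',
      L n (Ψ (q.1, ((n : ℝ) + 1)⁻¹ • q.2)) * (g q.1 * g' q.2)) Filter.atTop
      (nhds (c * ((∫ ξ, m ξ * g ξ) * ∫ η, g' η))) := by
  have hgg : Integrable (fun q : V × V' => g q.1 * g' q.2) := hg.mul_prod hg'
  have hint : ∫ q : V × V', c * m q.1 * (g q.1 * g' q.2) =
      c * ((∫ ξ, m ξ * g ξ) * ∫ η, g' η) := by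
    rw [← integral_prod_mul (fun ξ => m ξ * g ξ) g', ← integral_const_mul]
    refine integral_congr_ae (Filter.Eventually.of_forall fun q => ?_)
    simp only
    ring
  rw [← hint]
  refine tendsto_integral_of_dominated_convergence (fun q => ‖g q.1 * g' q.2‖) (fun n => ?_)
    hgg.norm (fun n => Filter.Eventually.of_forall fun q => ?_) ?_
  · have hmeas : Measurable (L n) := measurable_of_continuousOn_compl_singleton 0 (hL n)
    have hc : Continuous fun q : V × V' => Ψ (q.1, ((n : ℝ) + 1)⁻¹ • q.2) := by
      fun_prop
    exact (hmeas.comp hc.measurable).aestronglyMeasurable.mul hgg.1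
  · rw [norm_mul]
    exact mul_le_of_le_one_left (norm_nonneg _) (hL1 n _)
  · filter_upwards [hlim] with q hq using hq.mul_const _

/-! ### The main theorem -/

theorem theorem1p10 (M : FourSubspaceModule.{u}) (M' : FourSubspaceModule.{v})
    (D : BLDatum.{w}) (E : BLDatum.{x})
    (hD : D.toModule.Iso M) (hE : E.toModule.Iso (M.directSum M'))
    (p : Fin 3 → ℝ≥0∞) (hp_pos : ∀ i, 0 < p i) (hp_fin : ∀ i, p i < ∞) (l : ℕ)
    (h : ∃ C : ℝ≥0, E.BoundedWith p l C) :
    ∃ C' : ℝ≥0, D.BoundedWith p (2 * l) C' := by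
  obtain ⟨C, hC⟩ := h
  obtain ⟨D', Φ, Θ, hΦ⟩ := BLDatum.exists_complement hD hE
  have hinjD : D.IsJointlyInjective := fun v hv => by
    have h0 : Φ (v, 0) = 0 := hC.eq_zero_of_Pr_eq_zero fun i => by
      rw [hΦ, hv, map_zero]
      exact map_zero _
    simpa using (map_eq_zero_iff Φ Φ.injective).1 h0
  have hinjD' : D'.IsJointlyInjective := fun v hv => by
    have h0 : Φ (0, v) = 0 := hC.eq_zero_of_Pr_eq_zero fun i => by
      rw [hΦ, hv, map_zero]
      exact map_zero _
    simpa using (map_eq_zero_iff Φ Φ.injective).1 h0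
  obtain ⟨Ψ, A, κ, hbound⟩ := hC.exists_product_bound hp_pos hp_fin Φ Θ hΦ
  obtain ⟨f₀, g₀, hg₀, hg₀ne⟩ := hinjD.exists_integral_ne_zero
  obtain ⟨f', g', hg', hg'ne⟩ := hinjD'.exists_integral_ne_zero
  have hκ : κ ≤ 0 := by
    refine BLDatum.nonpos_of_enorm_le_rpow (a := ‖(∫ ξ, g₀ ξ) * ∫ η, g' η‖ₑ)
      (A := A * ((∏ i, eLpNorm (f₀ i) (p i) volume) * ∏ i, eLpNorm (f' i) (p i) volume))
      (by simpa using ⟨hg₀ne, hg'ne⟩)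
      (ENNReal.mul_ne_top ENNReal.coe_ne_top (ENNReal.mul_ne_top (D.prod_eLpNorm_ne_top f₀ p)
        (D'.prod_eLpNorm_ne_top f' p))) fun t ht => ?_
    have := hbound _ (isCZMultiplier_const l (c := 1) (by simp)) f₀ g₀ f' g' hg₀ hg' t ht
    simp only [one_mul] at this
    rw [Measure.volume_eq_prod, integral_prod_mul] at this
    refine this.trans (le_of_eq ?_)
    ring
  obtain ⟨B, hB, hlift⟩ := exists_isCZMultiplier_tendsto Ψ l
    (((Module.finrank ℝ (D.S 0) : ℝ) + 1) ^ l)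
  have hne : ‖∫ η, g' η‖ₑ ≠ 0 := by simpa using hg'ne
  set N' := ∏ i, eLpNorm (f' i) (p i) volume with hN'
  have hN't : N' ≠ ∞ := D'.prod_eLpNorm_ne_top f' p
  have hCt : ENNReal.ofReal B * A * N' / ‖∫ η, g' η‖ₑ ≠ ∞ :=
    ENNReal.div_ne_top (ENNReal.mul_ne_top (ENNReal.mul_ne_top ENNReal.ofReal_ne_top
      ENNReal.coe_ne_top) hN't) hne
  refine ⟨(ENNReal.ofReal B * A * N' / ‖∫ η, g' η‖ₑ).toNNReal, fun K hK f => ?_⟩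
  obtain ⟨g, hg, hfib⟩ := hinjD.exists_isFourierFiber f
  -- The lift loses no derivatives, so bounds of order `l` suffice.
  obtain ⟨m, hKm, hm1, hmik⟩ := hK.exists_multiplier (by omega : l ≤ 2 * l)
  refine ⟨K (𝓕 g), ⟨𝓕 g, hfib, rfl⟩, ?_⟩
  rw [show K (𝓕 g) = (𝓕 K) g from rfl, hKm, ENNReal.coe_toNNReal hCt]
  obtain ⟨L, hL, hlim⟩ := hlift m hm1 hmik
  have htend := tendsto_integral_multiplier (fun n => (hL n).contDiffOn.continuousOn)
    (fun n => (hL n).norm_le) hlim g.integrable g'.integrable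
  have hle : ‖((B⁻¹ : ℝ) : ℂ) * ((∫ ξ, m ξ * g ξ) * ∫ η, g' η)‖ₑ ≤
      A * ((∏ i, eLpNorm (f i) (p i) volume) * N') := by
    refine le_of_tendsto htend.enorm (Filter.Eventually.of_forall fun n => ?_)
    -- The dilation parameter `n + 1` matches the compression of the second variable in `hlim`.
    have hb := hbound (L n) (hL n) f g f' g' hg hg' ((n : ℝ) + 1) (by positivity)
    refine hb.trans ?_
    have h1 : ENNReal.ofReal (((n : ℝ) + 1) ^ κ) ≤ 1 := by
      rw [ENNReal.ofReal_le_one]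
      exact Real.rpow_le_one_of_one_le_of_nonpos (by linarith [(Nat.cast_nonneg n : (0 : ℝ) ≤ n)])
        hκ
    calc _ ≤ A * 1 * ((∏ i, eLpNorm (f i) (p i) volume) * N') := by gcongr
      _ = _ := by rw [mul_one]
  have hBe : ENNReal.ofReal B * ‖((B⁻¹ : ℝ) : ℂ)‖ₑ = 1 := by
    rw [← ofReal_norm, Complex.norm_real, Real.norm_of_nonneg (by positivity),
      ← ENNReal.ofReal_mul hB.le, mul_inv_cancel₀ hB.ne', ENNReal.ofReal_one]
  rw [div_eq_mul_inv, mul_right_comm, ← div_eq_mul_inv, ENNReal.le_div_iff_mul_le (Or.inl hne) (Or.inl enorm_ne_top)]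
  calc ‖∫ ξ, m ξ * g ξ‖ₑ * ‖∫ η, g' η‖ₑ
      = (ENNReal.ofReal B * ‖((B⁻¹ : ℝ) : ℂ)‖ₑ) * (‖∫ ξ, m ξ * g ξ‖ₑ * ‖∫ η, g' η‖ₑ) := by
        rw [hBe, one_mul]
    _ = ENNReal.ofReal B * ‖((B⁻¹ : ℝ) : ℂ) * ((∫ ξ, m ξ * g ξ) * ∫ η, g' η)‖ₑ := by
        rw [enorm_mul, enorm_mul, mul_assoc]
    _ ≤ ENNReal.ofReal B * (A * ((∏ i, eLpNorm (f i) (p i) volume) * N')) := by gcongr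
    _ = _ := by ring
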